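/- All graphs are finite and simple. For a graph $G$ without isolated vertices let $\mathcal A(G)=D^{-1/2}AD^{-1/2}$ be its normalized adjacency matrix, where $A$ is the adjacency matrix and $D$ the diagonal matrix of degrees; two such graphs are cospectral if their matrices $\mathcal A$ have the same eigenvalues with multiplicity. A spectral faux tree is a graph without isolated vertices which is not a tree but is cospectral with a tree. A full binary tree is a rooted tree in which every vertex has either zero or two children. It is plane if the two children of each vertex are distinguished as left and right; an isomorphism of rooted trees ignores this order. For $p\ge 1$ and $q\ge 2$, the $(p,q)$ ornamented $T$ is obtained from a full binary tree $T$ by adding, for every vertex $v$ with two children $v_+,v_-$, $p-1$ new vertices forming with $v$ a set of size $p$ and $q-2$ new vertices forming with $v_+,v_-$ a set of size $q$, and joining every vertex of the first set to every vertex of the second (a $K_{p,q}$). Corollary. Fix an integer $\alpha\ge 3$. (1) There are exponentially many (in $k$) pairwise non-isomorphic spectral faux trees on $n=1+\alpha k$ vertices: there is $c>1$ such that for all sufficiently large $k$ their number is at least $c^k$. (2) For every $k\ge 1$ and every full binary tree $T$ on $1+2k$ vertices, the $(1,\alpha)$ ornamented $T$ and the $(2,\alpha-1)$ ornamented $T$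 both have $1+\alpha k$ vertices, the former is a tree, the latter is not a tree, and the two are cospectral; so the $(2,\alpha-1)$ ornamented $T$ is a spectral faux tree. (3) For full binary trees $T,T'$, the $(2,\alpha-1)$ ornamented $T$ and the $(2,\alpha-1)$ ornamented $T'$ are isomorphic graphs if and only if $T$ and $T'$ are isomorphic as rooted trees. (4) For every $k\ge 1$, the number of plane full binary trees on $1+2k$ vertices is the Catalan number $C_k=\frac1{k+1}\binom{2k}{k}$. If $b_k$ is the number of full binary trees on $1+2k$ vertices up to isomorphism of rooted trees, then $b_k\ge C_k/2^{k-1}$, and there are at least $b_k$ pairwise non-isomorphic spectral faux trees on $1+\alpha k$ vertices. -/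

import Mathlib

/-! ### Full binary trees -/

/-- Full binary trees: a vertex has either no child or two children. A term also records which child
is drawn on the left (a plane tree); the underlying rooted tree is `T.Vertex` with `IsChild`. -/
inductive FullBinTree : Type
  | leaf : FullBinTree
  | node (l r : FullBinTree) : FullBinTree

namespace FullBinTree

/-- The vertices of a full binary tree: the root and, if the root has children, the vertices of the
two subtrees hanging below it. -/
inductive Vertex : FullBinTree → Type
  | root (T : FullBinTree) : Vertex T
  | left {l r : FullBinTree} (v : Vertex l) : Vertex (node l r)
  | right {l r : FullBinTree} (v : Vertex r) : Vertex (node l r)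

/-- `IsChild v w`: the vertex `w` is a child of the vertex `v`. -/
inductive IsChild : {T : FullBinTree} → T.Vertex → T.Vertex → Prop
  | rootLeft {l r : FullBinTree} : IsChild (Vertex.root (node l r)) (Vertex.left (Vertex.root l))
  | rootRight {l r : FullBinTree} : IsChild (Vertex.root (node l r)) (Vertex.right (Vertex.root r))
  | left {l r : FullBinTree} {v w : Vertex l} (h : IsChild v w) :
      IsChild (Vertex.left (r := r) v) (Vertex.left w)
  | right {l r : FullBinTree} {v w : Vertex r} (h : IsChild v w) :
      IsChild (Vertex.right (l := l) v) (Vertex.right w)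

instance finite_vertex (T : FullBinTree) : Finite T.Vertex := by
  induction T with
  | leaf =>
    refine Finite.of_surjective (fun _ : Unit => Vertex.root leaf) ?_
    intro v
    cases v
    exact ⟨(), rfl⟩
  | node l r hl hr =>
    refine Finite.of_surjective (fun x : Unit ⊕ (l.Vertex ⊕ r.Vertex) =>
      match x with
      | Sum.inl _ => Vertex.root (node l r)
      | Sum.inr (Sum.inl v) => Vertex.left v
      | Sum.inr (Sum.inr v) => Vertex.right v) ?_
    intro v
    cases v with
    | root => exact ⟨Sum.inl (), rfl⟩
    | left v => exact ⟨Sum.inr (Sum.inl v), rfl⟩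
    | right v => exact ⟨Sum.inr (Sum.inr v), rfl⟩

/-- Isomorphism of the underlying (unordered) rooted trees: a bijection between the vertices that
preserves and reflects the relation "is a child of". -/
def Iso (T T' : FullBinTree) : Prop :=
  Nonempty ((IsChild (T := T)) ≃r (IsChild (T := T')))

/-- Isomorphism of rooted trees as an equivalence relation. -/
def isoSetoid : Setoid FullBinTree where
  r := Iso
  iseqv :=
    { refl := fun _ => ⟨RelIso.refl _⟩
      symm := fun ⟨e⟩ => ⟨e.symm⟩
      trans := fun ⟨e⟩ ⟨f⟩ => ⟨e.trans f⟩ }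

/-- The number of full binary trees on `n` vertices, up to isomorphism of rooted trees. -/
noncomputable def numIsoClasses (n : ℕ) : ℕ :=
  ((Quotient.mk isoSetoid) '' {T : FullBinTree | Nat.card T.Vertex = n}).ncard

/-! ### Ornamented trees -/

/-- The vertices that have children. -/
abbrev Internal (T : FullBinTree) : Type := {v : T.Vertex // ∃ w, IsChild v w}

/-- The vertices of the `(p, q)` ornamented `T` (where `1 ≤ p` and `2 ≤ q`): the vertices of `T`
and, for every vertex with two children, `p - 1` and `q - 2` new vertices. -/
abbrev OrnVertex (T : FullBinTree) (p q : ℕ) : Type :=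
  T.Vertex ⊕ (T.Internal × (Fin (p - 1) ⊕ Fin (q - 2)))

/-- The part of size `p` of the block at `v`: the vertex `v` and its `p - 1` new vertices. -/
def InUpperPart {T : FullBinTree} {p q : ℕ} (v : T.Internal) : T.OrnVertex p q → Prop
  | Sum.inl u => u = v.1
  | Sum.inr (u, Sum.inl _) => u = v
  | Sum.inr (_, Sum.inr _) => False

/-- The part of size `q` of the block at `v`: the two children of `v` and the `q - 2` new vertices
that belong to `v`. -/
def InLowerPart {T : FullBinTree} {p q : ℕ} (v : T.Internal) : T.OrnVertex p q → Prop
  | Sum.inl u => IsChild v.1 u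
  | Sum.inr (_, Sum.inl _) => False
  | Sum.inr (u, Sum.inr _) => u = v

/-- The `(p, q)` ornamented `T` (where `1 ≤ p` and `2 ≤ q`): for every vertex `v` with two children,
the two parts of its block are joined completely, to a `K_{p,q}`. -/
def ornamented (T : FullBinTree) (p q : ℕ) : SimpleGraph (T.OrnVertex p q) :=
  SimpleGraph.fromRel fun x y => ∃ v : T.Internal, InUpperPart v x ∧ InLowerPart v y

noncomputable instance fintypeOrnVertex (T : FullBinTree) (p q : ℕ) :
    Fintype (T.OrnVertex p q) := Fintype.ofFinite _

end FullBinTree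

/-! ### The normalized adjacency matrix and spectral faux trees -/

open Classical in
/-- The normalized adjacency matrix `D^{-1/2} A D^{-1/2}`, used for graphs without isolated
vertices. -/
noncomputable def normAdjMatrix {V : Type*} [Fintype V] (G : SimpleGraph V) : Matrix V V ℝ :=
  Matrix.diagonal (fun v => (√(G.degree v : ℝ))⁻¹) * G.adjMatrix ℝ *
    Matrix.diagonal (fun v => (√(G.degree v : ℝ))⁻¹)

open Classical in
/-- The spectrum of the normalized adjacency matrix: its eigenvalues with multiplicity. -/
noncomputable def normAdjSpectrum {V : Type*} [Fintype V] (G : SimpleGraph V) : Multiset ℝ :=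
  (normAdjMatrix G).charpoly.roots

/-- A graph without isolated vertices. -/
def NoIsolatedVertices {V : Type*} (G : SimpleGraph V) : Prop := ∀ v, ∃ w, G.Adj v w

/-- A spectral faux tree for the normalized adjacency matrix: a graph without isolated vertices
that is not a tree but has the same spectrum as some tree (cospectral graphs have equally many
vertices, so the tree may be taken on the same vertex set). -/
def IsSpectralFauxTree {V : Type*} [Fintype V] (G : SimpleGraph V) : Prop :=
  NoIsolatedVertices G ∧ ¬ G.IsTree ∧
    ∃ H : SimpleGraph V, H.IsTree ∧ normAdjSpectrum G = normAdjSpectrum H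

/-- Graph isomorphism as an equivalence relation on the graphs with vertex set `Fin n`. -/
def graphIsoSetoid (n : ℕ) : Setoid (SimpleGraph (Fin n)) where
  r G H := Nonempty (G ≃g H)
  iseqv :=
    { refl := fun _ => ⟨SimpleGraph.Iso.refl⟩
      symm := fun ⟨e⟩ => ⟨e.symm⟩
      trans := fun ⟨e⟩ ⟨f⟩ => ⟨e.trans f⟩ }

/-- The number of spectral faux trees on `n` vertices, up to isomorphism. -/
noncomputable def numSpectralFauxTrees (n : ℕ) : ℕ :=
  ((Quotient.mk (graphIsoSetoid n)) '' {G | IsSpectralFauxTree G}).ncard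

/-!
The blocks of the `(p, q)` ornamented `T` are edge-disjoint copies of `K_{p,q}`, one for every vertex
of `T` with two children, so the adjacency matrix is a sum of rank two matrices. It factors as
`A = N J Nᵀ`, where the columns of `N` are the indicators of the upper and the lower parts of the
blocks and `J` interchanges the two parts of every block.

*Cospectrality.* Scaling upper columns by `√(q/p)` and lower columns by `√(p/q)` does not change
`N J Nᵀ`. Let `B` be `D^{-1/2} N` with columns scaled in this way (`blockMatrix`). The normalized
adjacency matrix is `B J Bᵀ`, and the entries of the Gram matrix `Bᵀ B` turn out to depend on `p` and
`q` only through `p + q` (`transpose_blockMatrix_mul`). Since `B (J Bᵀ)` and `(J Bᵀ) B` have the same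
characteristic polynomial up to a power of `X`, all ornamented trees of `T` with the same `p + q` are
cospectral (`normAdjSpectrum_ornamented`). They are connected, and counting edges shows which of them
are trees (`ornamented_isTree_iff`).

*Recovering `T`.* In the `(p, q)` ornamented `T` with `p, q ≥ 2`, the vertices of degree `p + q` are
the vertices of `T` that have children and are not the root. Two of them are siblings if and only if
they have more than one common neighbour. So an isomorphism of ornamented trees gives a bijection
between the vertices with children that preserves adjacency and siblings away from the root. Such a
bijection may reverse a parent and its child, but then the child has no sibling, and the same holds
at all edges above and below: the whole tree is a chain, and so is the other one, of the same length
(`Flipped.depth_injective`). Hence the trees of vertices with children are isomorphic in all cases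
(`PreservesSiblings.nonempty_relIso`), and attaching the leaves gives `T` and `T'`
(`swapEquiv_of_internal`).

*Counting.* Plane full binary trees are counted by the Catalan numbers. Two of them are isomorphic as
rooted trees if and only if they differ by swaps of the two subtrees at some vertices
(`iso_iff_swapEquiv`). A swap at a lowest vertex with children has no effect, so an isomorphism class
has at most `2 ^ (k - 1)` members (`ncard_swapEquiv_le`). As `C_k` is at least `4 ^ k / (k (k + 1))`,
the number of classes grows exponentially (`eventually_pow_le_numIsoClasses`).
-/

/-! ### Vertices of a full binary tree -/

namespace FullBinTree

/-- The number of vertices with two children. -/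
def numInternal : FullBinTree → ℕ
  | leaf => 0
  | node l r => l.numInternal + r.numInternal + 1

/-- The distance of a vertex from the root. -/
def depth : {T : FullBinTree} → T.Vertex → ℕ
  | _, Vertex.root _ => 0
  | _, Vertex.left v => depth v + 1
  | _, Vertex.right v => depth v + 1

/-- The subtree hanging at a vertex. -/
def sub : {T : FullBinTree} → T.Vertex → FullBinTree
  | _, Vertex.root T => T
  | _, Vertex.left v => sub v
  | _, Vertex.right v => sub v

lemma IsChild.depth_eq {T : FullBinTree} {v w : T.Vertex} (h : IsChild v w) :
    depth w = depth v + 1 := by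
  induction h with
  | rootLeft => rfl
  | rootRight => rfl
  | left h ih => simp [depth, ih]
  | right h ih => simp [depth, ih]

lemma IsChild.unique {T : FullBinTree} {v v' w : T.Vertex} (h : IsChild v w) (h' : IsChild v' w) :
    v = v' := by
  induction h with
  | rootLeft =>
    cases h' with
    | rootLeft => rfl
    | left h' => cases h'
  | rootRight =>
    cases h' with
    | rootRight => rfl
    | right h' => cases h'
  | left h ih =>
    cases h' with
    | rootLeft => cases h
    | left h' => rw [ih h']
  | right h ih =>
    cases h' with
    | rootRight => cases h
    | right h' => rw [ih h']

lemma depth_eq_zero {T : FullBinTree} {v : T.Vertex} : depth v = 0 ↔ v = Vertex.root T := by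
  cases v <;> simp [depth]

lemma exists_parent {T : FullBinTree} (v : T.Vertex) (hv : depth v ≠ 0) : ∃ p, IsChild p v := by
  induction v with
  | root T => exact absurd rfl hv
  | left v ih =>
    by_cases h : depth v = 0
    · rw [depth_eq_zero.1 h]
      exact ⟨_, .rootLeft⟩
    · obtain ⟨p, hp⟩ := ih h
      exact ⟨_, .left hp⟩
  | right v ih =>
    by_cases h : depth v = 0
    · rw [depth_eq_zero.1 h]
      exact ⟨_, .rootRight⟩
    · obtain ⟨p, hp⟩ := ih h
      exact ⟨_, .right hp⟩

/-- Every vertex is childless, or has exactly two children, at which the two subtrees of the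
subtree at the vertex hang. -/
lemma children_spec {T : FullBinTree} (v : T.Vertex) :
    (sub v = leaf ∧ ∀ w, ¬ IsChild v w) ∨
    ∃ a b, a ≠ b ∧ (∀ w, IsChild v w ↔ w = a ∨ w = b) ∧ sub v = node (sub a) (sub b) := by
  induction v with
  | root T =>
    cases T with
    | leaf => exact Or.inl ⟨rfl, fun w h => by cases h⟩
    | node l r =>
      refine Or.inr ⟨Vertex.left (Vertex.root l), Vertex.right (Vertex.root r), by simp, ?_, rfl⟩
      refine fun w => ⟨fun h => ?_, ?_⟩
      · cases h with
        | rootLeft => exact Or.inl rfl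
        | rootRight => exact Or.inr rfl
      · rintro (rfl | rfl)
        exacts [.rootLeft, .rootRight]
  | left v ih =>
    rcases ih with ⟨h, hw⟩ | ⟨a, b, hab, hw, h⟩
    · exact Or.inl ⟨h, fun w h => by cases h with | left h => exact hw _ h⟩
    · refine Or.inr ⟨.left a, .left b, by simpa using hab, fun w => ⟨fun h => ?_, ?_⟩, h⟩
      · cases h with
        | left h => simpa using (hw _).1 h
      · rintro (rfl | rfl)
        exacts [.left ((hw _).2 (Or.inl rfl)), .left ((hw _).2 (Or.inr rfl))]
  | right v ih =>
    rcases ih with ⟨h, hw⟩ | ⟨a, b, hab, hw, h⟩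
    · exact Or.inl ⟨h, fun w h => by cases h with | right h => exact hw _ h⟩
    · refine Or.inr ⟨.right a, .right b, by simpa using hab, fun w => ⟨fun h => ?_, ?_⟩, h⟩
      · cases h with
        | right h => simpa using (hw _).1 h
      · rintro (rfl | rfl)
        exacts [.right ((hw _).2 (Or.inl rfl)), .right ((hw _).2 (Or.inr rfl))]

lemma exists_children {T : FullBinTree} (v : T.Internal) :
    ∃ a b, a ≠ b ∧ (∀ w, IsChild v.1 w ↔ w = a ∨ w = b) ∧ sub v.1 = node (sub a) (sub b) := by
  obtain ⟨w, hw⟩ := v.2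
  rcases children_spec v.1 with ⟨-, h⟩ | h
  exacts [absurd hw (h w), h]

lemma sub_eq_leaf_iff {T : FullBinTree} (v : T.Vertex) :
    sub v = leaf ↔ ¬ ∃ w, IsChild v w := by
  rcases children_spec v with ⟨h, hw⟩ | ⟨a, b, -, hw, h⟩
  · simpa [h] using hw
  · simp [h, hw]

/-- The vertices of a tree with children: the root and the vertices of the two subtrees. -/
def vertexEquiv (l r : FullBinTree) : (node l r).Vertex ≃ Unit ⊕ (l.Vertex ⊕ r.Vertex) where
  toFun v := match v with
    | .root _ => .inl ()
    | .left v => .inr (.inl v)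
    | .right v => .inr (.inr v)
  invFun x := match x with
    | .inl _ => .root _
    | .inr (.inl v) => .left v
    | .inr (.inr v) => .right v
  left_inv v := by cases v <;> rfl
  right_inv x := by rcases x with _ | _ | _ <;> rfl

lemma card_vertex (T : FullBinTree) : Nat.card T.Vertex = 1 + 2 * T.numInternal := by
  induction T with
  | leaf =>
    have : Unique (Vertex leaf) := ⟨⟨.root _⟩, fun v => by cases v; rfl⟩
    simp [numInternal]
  | node l r hl hr =>
    rw [Nat.card_congr (vertexEquiv l r), Nat.card_sum, Nat.card_sum, hl, hr, Nat.card_unique,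
      numInternal]
    ring

lemma card_internal (T : FullBinTree) : Nat.card T.Internal = T.numInternal := by
  induction T with
  | leaf =>
    have : IsEmpty (Internal leaf) := ⟨fun ⟨v, w, h⟩ => by cases h⟩
    simp [numInternal]
  | node l r hl hr =>
    have hleft (v : l.Vertex) : (∃ w, IsChild (Vertex.left (r := r) v) w) ↔ ∃ w, IsChild v w := by
      rw [← not_iff_not, ← sub_eq_leaf_iff, ← sub_eq_leaf_iff, sub]
    have hright (v : r.Vertex) : (∃ w, IsChild (Vertex.right (l := l) v) w) ↔ ∃ w, IsChild v w := by
      rw [← not_iff_not, ← sub_eq_leaf_iff, ← sub_eq_leaf_iff, sub]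
    let e : Internal (node l r) ≃ Unit ⊕ (l.Internal ⊕ r.Internal) :=
      { toFun := fun v => match v with
          | ⟨.root _, _⟩ => .inl ()
          | ⟨.left v, h⟩ => .inr (.inl ⟨v, (hleft v).1 h⟩)
          | ⟨.right v, h⟩ => .inr (.inr ⟨v, (hright v).1 h⟩)
        invFun := fun x => match x with
          | .inl _ => ⟨.root _, _, .rootLeft⟩
          | .inr (.inl v) => ⟨.left v.1, (hleft _).2 v.2⟩
          | .inr (.inr v) => ⟨.right v.1, (hright _).2 v.2⟩
        left_inv := by rintro ⟨_ | _ | _, _⟩ <;> rfl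
        right_inv := by rintro (_ | _ | _) <;> rfl }
    rw [Nat.card_congr e, Nat.card_sum, Nat.card_sum, hl, hr, Nat.card_unique, numInternal]
    ring

lemma card_ornVertex (T : FullBinTree) (p q : ℕ) :
    Nat.card (T.OrnVertex p q) = 1 + T.numInternal * (p - 1 + (q - 2) + 2) := by
  rw [Nat.card_sum, Nat.card_prod, Nat.card_sum, card_vertex, card_internal, Nat.card_fin,
    Nat.card_fin]
  ring

end FullBinTree

/-! ### Adjacency and degrees in ornamented trees -/

namespace FullBinTree

variable {T : FullBinTree} {p q : ℕ}

noncomputable instance fintypeInternal (T : FullBinTree) : Fintype T.Internal := Fintype.ofFinite _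

noncomputable instance fintypeVertex (T : FullBinTree) : Fintype T.Vertex := Fintype.ofFinite _

/-- The height function of an ornamented tree for which every edge of the block at `v` leads from
level `depth v` to level `depth v + 1`. -/
def level : T.OrnVertex p q → ℕ
  | .inl u => depth u
  | .inr (u, .inl _) => depth u.1
  | .inr (u, .inr _) => depth u.1 + 1

lemma InUpperPart.level_eq {v : T.Internal} {x : T.OrnVertex p q} (h : InUpperPart v x) :
    level x = depth v.1 := by
  rcases x with u | ⟨u, i | i⟩
  · rw [show u = v.1 from h]; rfl
  · rw [show u = v from h]; rfl
  · exact h.elim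

lemma InLowerPart.level_eq {v : T.Internal} {x : T.OrnVertex p q} (h : InLowerPart v x) :
    level x = depth v.1 + 1 := by
  rcases x with u | ⟨u, i | i⟩
  · exact IsChild.depth_eq h
  · exact h.elim
  · rw [show u = v from h]; rfl

lemma InUpperPart.unique {v w : T.Internal} {x : T.OrnVertex p q} (h : InUpperPart v x)
    (h' : InUpperPart w x) : v = w := by
  rcases x with u | ⟨u, i | i⟩
  · exact Subtype.ext ((show u = v.1 from h).symm.trans h')
  · exact (show u = v from h).symm.trans h'
  · exact h.elim

lemma InLowerPart.unique {v w : T.Internal} {x : T.OrnVertex p q} (h : InLowerPart v x)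
    (h' : InLowerPart w x) : v = w := by
  rcases x with u | ⟨u, i | i⟩
  · exact Subtype.ext (IsChild.unique h h')
  · exact h.elim
  · exact (show u = v from h).symm.trans h'

/-- Two different blocks can only meet in a vertex of `T`. -/
lemma eq_inl_of_upper_of_lower {v w : T.Internal} {x : T.OrnVertex p q} (h : InUpperPart v x)
    (h' : InLowerPart w x) : x = .inl v.1 := by
  rcases x with u | ⟨u, i | i⟩
  · rw [show u = v.1 from h]
  · exact h'.elim
  · exact h.elim

lemma ornamented_adj {x y : T.OrnVertex p q} : (T.ornamented p q).Adj x y ↔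
    ∃ v : T.Internal,
      (InUpperPart v x ∧ InLowerPart v y) ∨ (InLowerPart v x ∧ InUpperPart v y) := by
  rw [ornamented, SimpleGraph.fromRel_adj]
  constructor
  · rintro ⟨-, ⟨v, h⟩ | ⟨v, h⟩⟩
    exacts [⟨v, .inl h⟩, ⟨v, .inr h.symm⟩]
  · rintro ⟨v, h⟩
    refine ⟨?_, ?_⟩
    · rintro rfl
      rcases h with h | h
      · have := h.1.level_eq; have := h.2.level_eq; omega
      · have := h.1.level_eq; have := h.2.level_eq; omega
    · rcases h with h | h
      exacts [.inl ⟨v, h⟩, .inr ⟨v, h.symm⟩]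

lemma inUpperPart_inl (v : T.Internal) : InUpperPart v (.inl v.1 : T.OrnVertex p q) := rfl

lemma inLowerPart_inr (v : T.Internal) (i : Fin (q - 2)) :
    InLowerPart v (.inr (v, .inr i) : T.OrnVertex p q) := rfl

lemma ornamented_adj_of_isChild {v w : T.Vertex} (h : IsChild v w) :
    (T.ornamented p q).Adj (.inl v) (.inl w) :=
  ornamented_adj.2 ⟨⟨v, w, h⟩, .inl ⟨inUpperPart_inl ⟨v, w, h⟩, h⟩⟩

lemma ornamented_adj_upper_of_isChild (v : T.Internal) (i : Fin (p - 1)) {w : T.Vertex}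
    (h : IsChild v.1 w) : (T.ornamented p q).Adj (.inr (v, .inl i)) (.inl w) :=
  ornamented_adj.2 ⟨v, .inl ⟨rfl, h⟩⟩

open Classical in
/-- The indicator function of the upper part of the block at `v`. -/
noncomputable def upperInd (p q : ℕ) (v : T.Internal) (x : T.OrnVertex p q) : ℝ :=
  if InUpperPart v x then 1 else 0

open Classical in
/-- The indicator function of the lower part of the block at `v`. -/
noncomputable def lowerInd (p q : ℕ) (v : T.Internal) (x : T.OrnVertex p q) : ℝ :=
  if InLowerPart v x then 1 else 0

section Values

variable (v : T.Internal) (u : T.Vertex) (w : T.Internal)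

open Classical in
lemma upperInd_inl : upperInd p q v (.inl u) = if u = v.1 then 1 else 0 :=
  if_congr Iff.rfl rfl rfl

open Classical in
lemma upperInd_upper (i : Fin (p - 1)) :
    upperInd p q v (.inr (w, .inl i)) = if w = v then 1 else 0 :=
  if_congr Iff.rfl rfl rfl

lemma upperInd_lower (i : Fin (q - 2)) : upperInd p q v (.inr (w, .inr i)) = 0 := if_neg id

open Classical in
lemma lowerInd_inl : lowerInd p q v (.inl u) = if IsChild v.1 u then 1 else 0 :=
  if_congr Iff.rfl rfl rfl

lemma lowerInd_upper (i : Fin (p - 1)) : lowerInd p q v (.inr (w, .inl i)) = 0 := if_neg id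

open Classical in
lemma lowerInd_lower (i : Fin (q - 2)) :
    lowerInd p q v (.inr (w, .inr i)) = if w = v then 1 else 0 :=
  if_congr Iff.rfl rfl rfl

end Values

lemma sum_ornVertex (f : T.OrnVertex p q → ℝ) : ∑ x, f x =
    ∑ u, f (.inl u) +
      ∑ v : T.Internal, (∑ i, f (.inr (v, .inl i)) + ∑ i, f (.inr (v, .inr i))) := by
  rw [Subsingleton.elim (fintypeOrnVertex T p q) (instFintypeSum _ _), Fintype.sum_sum_type,
    Fintype.sum_prod_type]
  simp_rw [Fintype.sum_sum_type]

lemma sum_upperInd_mul (v : T.Internal) (f : T.OrnVertex p q → ℝ) :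
    ∑ x, upperInd p q v x * f x = f (.inl v.1) + ∑ i, f (.inr (v, .inl i)) := by
  classical
  simp [sum_ornVertex, upperInd_inl, upperInd_upper, upperInd_lower]

open Classical in
lemma sum_lowerInd_mul (v : T.Internal) (f : T.OrnVertex p q → ℝ) :
    ∑ x, lowerInd p q v x * f x =
      ∑ u with IsChild v.1 u, f (.inl u) + ∑ i, f (.inr (v, .inr i)) := by
  simp [sum_ornVertex, lowerInd_inl, lowerInd_upper, lowerInd_lower, Finset.sum_filter]

open Classical in
lemma filter_isChild (v : T.Internal) :
    ∃ a b, a ≠ b ∧ Finset.univ.filter (IsChild v.1) = {a, b} := by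
  obtain ⟨a, b, hab, h, -⟩ := exists_children v
  exact ⟨a, b, hab, by ext; simp [h]⟩

lemma sum_upperInd (hp : 1 ≤ p) (v : T.Internal) : ∑ x, upperInd p q v x = p := by
  simpa [hp] using sum_upperInd_mul (p := p) (q := q) v 1

lemma sum_lowerInd (hq : 2 ≤ q) (v : T.Internal) : ∑ x, lowerInd p q v x = q := by
  classical
  obtain ⟨a, b, hab, h⟩ := filter_isChild v
  have := sum_lowerInd_mul (p := p) (q := q) v 1
  simpa [h, hab, hq] using this

/-- The adjacency matrix of the ornamented tree is the sum of those of its blocks. -/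
lemma ornamented_adj_eq_sum (x y : T.OrnVertex p q) [Decidable ((T.ornamented p q).Adj x y)] :
    (if (T.ornamented p q).Adj x y then 1 else 0 : ℝ) = ∑ v : T.Internal,
      (upperInd p q v x * lowerInd p q v y + lowerInd p q v x * upperInd p q v y) := by
  classical
  split_ifs with h
  · obtain ⟨v, h⟩ := ornamented_adj.1 h
    rw [Finset.sum_eq_single v]
    · rcases h with ⟨h, h'⟩ | ⟨h, h'⟩
      · have h1 : ¬ InLowerPart v x := fun hx => by have := h.level_eq; have := hx.level_eq; omega
        simp [upperInd, lowerInd, h, h', h1]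
      · have h1 : ¬ InUpperPart v x := fun hx => by have := h.level_eq; have := hx.level_eq; omega
        simp [upperInd, lowerInd, h, h', h1]
    · intro w _ hw
      have h1 : ¬ (InUpperPart w x ∧ InLowerPart w y) := by
        rintro ⟨hx, hy⟩
        rcases h with ⟨h, h'⟩ | ⟨h, h'⟩
        · exact hw (hx.unique h)
        · have := h.level_eq; have := h'.level_eq; have := hx.level_eq; have := hy.level_eq; omega
      have h2 : ¬ (InLowerPart w x ∧ InUpperPart w y) := by
        rintro ⟨hx, hy⟩
        rcases h with ⟨h, h'⟩ | ⟨h, h'⟩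
        · have := h.level_eq; have := h'.level_eq; have := hx.level_eq; have := hy.level_eq; omega
        · exact hw (hx.unique h)
      simp only [upperInd, lowerInd, mul_ite, mul_one, mul_zero, ← ite_and]
      rw [if_neg (by tauto), if_neg (by tauto), add_zero]
    · simp
  · rw [ornamented_adj] at h
    push Not at h
    refine (Finset.sum_eq_zero fun v _ => ?_).symm
    simp only [upperInd, lowerInd, mul_ite, mul_one, mul_zero, ← ite_and]
    rw [if_neg (fun h' => (h v).1 h'.2 h'.1), if_neg (fun h' => (h v).2 h'.2 h'.1), add_zero]

lemma degree_eq_sum (hp : 1 ≤ p) (hq : 2 ≤ q) (x : T.OrnVertex p q)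
    [Fintype ((T.ornamented p q).neighborSet x)] : ((T.ornamented p q).degree x : ℝ) =
      ∑ v : T.Internal, (upperInd p q v x * q + lowerInd p q v x * p) := by
  classical
  have h : ((T.ornamented p q).degree x : ℝ) =
      ∑ y, if (T.ornamented p q).Adj x y then (1 : ℝ) else 0 := by
    rw [Finset.sum_boole, ← SimpleGraph.card_neighborFinset_eq_degree]
    congr 2
    ext y
    simp
  rw [h]
  simp_rw [ornamented_adj_eq_sum]
  rw [Finset.sum_comm]
  refine Finset.sum_congr rfl fun v _ => ?_
  rw [Finset.sum_add_distrib, ← Finset.mul_sum, ← Finset.mul_sum, sum_lowerInd hq, sum_upperInd hp]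

open Classical in
lemma sum_upperInd_inl (u : T.Vertex) : ∑ v : T.Internal, upperInd p q v (.inl u) =
    if ∃ w, IsChild u w then 1 else 0 := by
  split_ifs with h
  · rw [Finset.sum_eq_single ⟨u, h⟩]
    · exact if_pos rfl
    · exact fun v _ hv => if_neg fun h' => hv (Subtype.ext (show u = v.1 from h').symm)
    · simp
  · exact Finset.sum_eq_zero fun v _ => if_neg fun h' => h ((show u = v.1 from h') ▸ v.2)

open Classical in
lemma sum_lowerInd_inl (u : T.Vertex) : ∑ v : T.Internal, lowerInd p q v (.inl u) =
    if u = .root T then 0 else 1 := by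
  split_ifs with h
  · refine Finset.sum_eq_zero fun v _ => if_neg fun h' => ?_
    have := IsChild.depth_eq (show IsChild v.1 u from h')
    rw [depth_eq_zero.2 h] at this
    omega
  · obtain ⟨v, hv⟩ := exists_parent u (mt depth_eq_zero.1 h)
    rw [Finset.sum_eq_single ⟨v, u, hv⟩]
    · exact if_pos hv
    · exact fun w _ hw => if_neg fun h' =>
        hw (Subtype.ext (IsChild.unique (show IsChild w.1 u from h') hv))
    · simp

open Classical in
lemma degree_inl (hp : 1 ≤ p) (hq : 2 ≤ q) (u : T.Vertex)
    [Fintype ((T.ornamented p q).neighborSet (.inl u))] :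
    (T.ornamented p q).degree (.inl u) =
      (if ∃ w, IsChild u w then q else 0) + (if u = .root T then 0 else p) := by
  have := degree_eq_sum hp hq (.inl u : T.OrnVertex p q)
  rw [Finset.sum_add_distrib, ← Finset.sum_mul, ← Finset.sum_mul, sum_upperInd_inl,
    sum_lowerInd_inl] at this
  rw [← Nat.cast_inj (R := ℝ), this]
  push_cast
  simp only [ite_mul, one_mul, zero_mul]

lemma degree_upper (hp : 1 ≤ p) (hq : 2 ≤ q) (v : T.Internal) (i : Fin (p - 1))
    [Fintype ((T.ornamented p q).neighborSet (.inr (v, .inl i)))] :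
    (T.ornamented p q).degree (.inr (v, .inl i)) = q := by
  classical
  have := degree_eq_sum hp hq (.inr (v, .inl i) : T.OrnVertex p q)
  simpa [upperInd_upper, lowerInd_upper] using this

lemma degree_lower (hp : 1 ≤ p) (hq : 2 ≤ q) (v : T.Internal) (i : Fin (q - 2))
    [Fintype ((T.ornamented p q).neighborSet (.inr (v, .inr i)))] :
    (T.ornamented p q).degree (.inr (v, .inr i)) = p := by
  classical
  have := degree_eq_sum hp hq (.inr (v, .inr i) : T.OrnVertex p q)
  simpa [upperInd_lower, lowerInd_lower] using this

/-- The blocks are edge-disjoint copies of `K_{p,q}`. -/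
lemma card_edgeSet_ornamented (hp : 1 ≤ p) (hq : 2 ≤ q) :
    Nat.card (T.ornamented p q).edgeSet = T.numInternal * (p * q) := by
  classical
  have h := (T.ornamented p q).sum_degrees_eq_twice_card_edges
  have h' : (∑ x, (T.ornamented p q).degree x : ℝ) = T.numInternal * (2 * (p * q)) := by
    simp_rw [degree_eq_sum hp hq]
    rw [Finset.sum_comm, ← card_internal, Nat.card_eq_fintype_card, ← nsmul_eq_mul,
      ← Finset.card_univ, ← Finset.sum_const]
    refine Finset.sum_congr rfl fun v _ => ?_
    rw [Finset.sum_add_distrib, ← Finset.sum_mul, ← Finset.sum_mul, sum_upperInd hp,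
      sum_lowerInd hq]
    ring
  have h2 : 2 * (T.ornamented p q).edgeFinset.card = T.numInternal * (2 * (p * q)) := by
    rw [← h]
    exact_mod_cast h'
  rw [Nat.card_eq_fintype_card, ← SimpleGraph.edgeFinset_card]
  linarith

lemma ornamented_reachable_root (u : T.Vertex) :
    (T.ornamented p q).Reachable (.inl u) (.inl (.root T)) := by
  induction h : depth u generalizing u with
  | zero => rw [depth_eq_zero.1 h]
  | succ n ih =>
    obtain ⟨v, hv⟩ := exists_parent u (by omega)
    have hd := hv.depth_eq
    exact (SimpleGraph.Adj.reachable
      (ornamented_adj_of_isChild hv).symm).trans (ih v (by omega))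

lemma ornamented_connected : (T.ornamented p q).Connected := by
  refine SimpleGraph.connected_iff_exists_forall_reachable _ |>.2
    ⟨.inl (.root T), fun x => SimpleGraph.Reachable.symm ?_⟩
  rcases x with u | ⟨v, i | i⟩
  · exact ornamented_reachable_root u
  · obtain ⟨w, hw⟩ := v.2
    exact (SimpleGraph.Adj.reachable (ornamented_adj_upper_of_isChild v i hw)).trans
      (ornamented_reachable_root w)
  · have h : (T.ornamented p q).Adj (.inr (v, .inr i)) (.inl v.1) :=
      ornamented_adj.2 ⟨v, .inr ⟨inLowerPart_inr v i, inUpperPart_inl v⟩⟩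
    exact h.reachable.trans (ornamented_reachable_root v.1)

lemma ornamented_isTree_iff (hp : 1 ≤ p) (hq : 2 ≤ q) :
    (T.ornamented p q).IsTree ↔ T.numInternal * (p * q) = T.numInternal * (p + q - 1) := by
  rw [SimpleGraph.isTree_iff_connected_and_card, card_edgeSet_ornamented hp hq, card_ornVertex,
    and_iff_right (ornamented_connected), add_comm, Nat.add_left_cancel_iff,
    show p - 1 + (q - 2) + 2 = p + q - 1 by omega]

lemma ornamented_noIsolatedVertices (hT : T.numInternal ≠ 0) :
    NoIsolatedVertices (T.ornamented p q) := by
  have : Nontrivial (T.OrnVertex p q) := by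
    rw [← Finite.one_lt_card_iff_nontrivial, card_ornVertex]
    have : 0 < T.numInternal * (p - 1 + (q - 2) + 2) := by positivity
    omega
  exact fun v => (ornamented_connected).preconnected.exists_adj_of_nontrivial v

end FullBinTree

/-! ### The spectrum of an ornamented tree -/

/-- Isomorphic graphs are cospectral. -/
lemma normAdjSpectrum_eq_of_iso {V W : Type*} [Fintype V] [Fintype W] {G : SimpleGraph V}
    {H : SimpleGraph W} (e : G ≃g H) : normAdjSpectrum G = normAdjSpectrum H := by
  classical
  have h : normAdjMatrix H = Matrix.reindex e.toEquiv e.toEquiv (normAdjMatrix G) := by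
    ext x y
    have hd (x : W) : G.degree (e.symm x) = H.degree x := by
      rw [← e.degree_eq, RelIso.apply_symm_apply]
    have ha : G.Adj (e.symm x) (e.symm y) ↔ H.Adj x y := e.symm.map_adj_iff
    have hs (x : W) : e.toEquiv.symm x = e.symm x := rfl
    simp only [normAdjMatrix, Matrix.diagonal_mul, Matrix.mul_diagonal, Matrix.reindex_apply,
      Matrix.submatrix_apply, SimpleGraph.adjMatrix_apply, hs]
    congr! 5
    all_goals first | exact (hd _).symm | exact ha.symm
  rw [normAdjSpectrum, normAdjSpectrum, h]
  congr 1
  convert (Matrix.charpoly_reindex e.toEquiv (normAdjMatrix G)).symm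

namespace FullBinTree

variable {T : FullBinTree} {p q : ℕ}

/-- The incidence matrix between the vertices and the upper and lower parts of the blocks, with
rows scaled by `D^{-1/2}`. The two weights `√(q/p)` and `√(p/q)` are inverse to each other, so that
they do not affect the adjacency matrix; they balance the Gram matrix of the columns. -/
noncomputable def blockMatrix (T : FullBinTree) (p q : ℕ) :
    Matrix (T.OrnVertex p q) (T.Internal ⊕ T.Internal) ℝ := fun x j =>
  open Classical in
  (√((T.ornamented p q).degree x : ℝ))⁻¹ *
    Sum.elim (fun v => √(q / p) * upperInd p q v x) (fun v => √(p / q) * lowerInd p q v x) j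

/-- The transpose of `blockMatrix` with upper and lower parts interchanged. -/
noncomputable def swappedBlockMatrix (T : FullBinTree) (p q : ℕ) :
    Matrix (T.Internal ⊕ T.Internal) (T.OrnVertex p q) ℝ := fun j x => T.blockMatrix p q x j.swap

open Classical in
/-- The Gram matrix of the columns of `blockMatrix`, as a function of `α = p + q`. If `i` of
the two children of `v` have children, then the diagonal entry at the lower part of `v` is
`1 - i / α`. -/
noncomputable def gramMatrix (T : FullBinTree) (α : ℝ) :
    Matrix (T.Internal ⊕ T.Internal) (T.Internal ⊕ T.Internal) ℝ
  | .inl v, .inl w => if v = w then (if v.1 = .root T then 1 else 1 - 1 / α) else 0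
  | .inr v, .inr w =>
      if v = w then ∑ u with IsChild v.1 u, (1 / 2 - (if ∃ w, IsChild u w then 1 / α else 0)) else 0
  | .inl v, .inr w => if IsChild w.1 v.1 then 1 / α else 0
  | .inr v, .inl w => if IsChild v.1 w.1 then 1 / α else 0

lemma sqrt_div_mul_sqrt_div (hp : p ≠ 0) (hq : q ≠ 0) : √(q / p : ℝ) * √(p / q) = 1 := by
  rw [← Real.sqrt_mul (by positivity), div_mul_div_cancel₀ (by positivity),
    div_self (by positivity), Real.sqrt_one]

lemma normAdjMatrix_ornamented (hp : 1 ≤ p) (hq : 2 ≤ q) :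
    normAdjMatrix (T.ornamented p q) = T.blockMatrix p q * T.swappedBlockMatrix p q := by
  classical
  ext x y
  have hw := sqrt_div_mul_sqrt_div (p := p) (q := q) (by omega) (by omega)
  rw [Matrix.mul_apply, Fintype.sum_sum_type]
  simp only [normAdjMatrix, Matrix.diagonal_mul, Matrix.mul_diagonal, SimpleGraph.adjMatrix_apply,
    ornamented_adj_eq_sum, blockMatrix, swappedBlockMatrix, Sum.elim_inl, Sum.elim_inr,
    Sum.swap_inl, Sum.swap_inr]
  rw [← Finset.sum_add_distrib, Finset.mul_sum, Finset.sum_mul]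
  refine Finset.sum_congr rfl fun v _ => ?_
  linear_combination (-(√((T.ornamented p q).degree x : ℝ))⁻¹ *
    (√((T.ornamented p q).degree y : ℝ))⁻¹ * (upperInd p q v x * lowerInd p q v y +
      lowerInd p q v x * upperInd p q v y)) * hw

lemma upperInd_mul_self (v : T.Internal) (x : T.OrnVertex p q) :
    upperInd p q v x * upperInd p q v x = upperInd p q v x := by simp [upperInd]

lemma lowerInd_mul_self (v : T.Internal) (x : T.OrnVertex p q) :
    lowerInd p q v x * lowerInd p q v x = lowerInd p q v x := by simp [lowerInd]

lemma upperInd_mul_upperInd {v w : T.Internal} (h : v ≠ w) (x : T.OrnVertex p q) :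
    upperInd p q v x * upperInd p q w x = 0 := by
  by_cases hv : InUpperPart v x
  · rw [upperInd, upperInd, if_neg (fun hw => h (hv.unique hw)), mul_zero]
  · rw [upperInd, if_neg hv, zero_mul]

lemma lowerInd_mul_lowerInd {v w : T.Internal} (h : v ≠ w) (x : T.OrnVertex p q) :
    lowerInd p q v x * lowerInd p q w x = 0 := by
  by_cases hv : InLowerPart v x
  · rw [lowerInd, lowerInd, if_neg (fun hw => h (hv.unique hw)), mul_zero]
  · rw [lowerInd, if_neg hv, zero_mul]

open Classical in
lemma sum_upperInd_div_degree (hp : 1 ≤ p) (hq : 2 ≤ q) (v : T.Internal) :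
    q / p * ∑ x, upperInd p q v x * (1 / ((T.ornamented p q).degree x : ℝ)) =
      if v.1 = .root T then 1 else 1 - 1 / ((p + q : ℕ) : ℝ) := by
  have hp' : (p : ℝ) ≠ 0 := by positivity
  have hq' : (q : ℝ) ≠ 0 := by positivity
  have hpq : (p + q : ℝ) ≠ 0 := by positivity
  rw [sum_upperInd_mul]
  simp only [degree_upper hp hq, degree_inl hp hq, if_pos v.2]
  rw [Finset.sum_const, Finset.card_univ, Fintype.card_fin, nsmul_eq_mul, Nat.cast_sub hp]
  split_ifs with h
  · push_cast
    field_simp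
    ring
  · push_cast
    rw [add_comm (q : ℝ)]
    field_simp
    ring

open Classical in
lemma sum_lowerInd_div_degree (hp : 1 ≤ p) (hq : 2 ≤ q) (v : T.Internal) :
    p / q * ∑ x, lowerInd p q v x * (1 / ((T.ornamented p q).degree x : ℝ)) =
      ∑ u with IsChild v.1 u,
        (1 / 2 - (if ∃ w, IsChild u w then 1 / ((p + q : ℕ) : ℝ) else 0)) := by
  have hp' : (p : ℝ) ≠ 0 := by positivity
  have hq' : (q : ℝ) ≠ 0 := by positivity
  have hpq : (p + q : ℝ) ≠ 0 := by positivity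
  obtain ⟨a, b, hab, hv⟩ := filter_isChild v
  have hroot {c : T.Vertex} (hc : c ∈ ({a, b} : Finset T.Vertex)) : c ≠ .root T := by
    rw [← hv, Finset.mem_filter] at hc
    rintro rfl
    exact absurd hc.2.depth_eq (by simp [depth])
  rw [sum_lowerInd_mul]
  simp only [degree_lower hp hq, hv, Finset.sum_pair hab, degree_inl hp hq,
    if_neg (hroot (show a ∈ {a, b} by simp)), if_neg (hroot (show b ∈ {a, b} by simp))]
  rw [Finset.sum_const, Finset.card_univ, Fintype.card_fin, nsmul_eq_mul, Nat.cast_sub hq]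
  split_ifs <;>
  · push_cast
    try rw [add_comm (q : ℝ)]
    field_simp
    ring

open Classical in
lemma sum_upperInd_mul_lowerInd_div_degree (hp : 1 ≤ p) (hq : 2 ≤ q) (v w : T.Internal) :
    ∑ x, upperInd p q v x * lowerInd p q w x * (1 / ((T.ornamented p q).degree x : ℝ)) =
      if IsChild w.1 v.1 then 1 / ((p + q : ℕ) : ℝ) else 0 := by
  simp only [mul_assoc, sum_upperInd_mul, lowerInd_inl, lowerInd_upper, degree_inl hp hq,
    if_pos v.2]
  split_ifs with h h' h'
  · exact absurd h.depth_eq (by simp [h', depth])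
  · simp [add_comm]
  · simp
  · simp

/-- The Gram matrix of the two parts of all blocks depends only on `p + q`. -/
lemma transpose_blockMatrix_mul (hp : 1 ≤ p) (hq : 2 ≤ q) :
    (T.blockMatrix p q).transpose * T.blockMatrix p q = T.gramMatrix ((p + q : ℕ) : ℝ) := by
  classical
  have hw := sqrt_div_mul_sqrt_div (p := p) (q := q) (by omega) (by omega)
  have hw1 : √(q / p : ℝ) * √(q / p) = q / p := Real.mul_self_sqrt (by positivity)
  have hw2 : √(p / q : ℝ) * √(p / q) = p / q := Real.mul_self_sqrt (by positivity)
  have hd (x : T.OrnVertex p q) : (√((T.ornamented p q).degree x : ℝ))⁻¹ *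
      (√((T.ornamented p q).degree x : ℝ))⁻¹ = 1 / (T.ornamented p q).degree x := by
    rw [← mul_inv, Real.mul_self_sqrt (by positivity), one_div]
  ext j k
  rw [Matrix.mul_apply]
  simp only [Matrix.transpose_apply, blockMatrix]
  rcases j with v | v <;> rcases k with w | w <;> simp only [Sum.elim_inl, Sum.elim_inr, gramMatrix]
  · split_ifs with hvw hroot
    · subst hvw
      rw [← (sum_upperInd_div_degree hp hq v).trans (if_pos hroot), Finset.mul_sum]
      refine Finset.sum_congr rfl fun x _ => ?_
      rw [mul_mul_mul_comm, hd, mul_mul_mul_comm √_, hw1, upperInd_mul_self]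
      ring
    · subst hvw
      rw [← (sum_upperInd_div_degree hp hq v).trans (if_neg hroot), Finset.mul_sum]
      refine Finset.sum_congr rfl fun x _ => ?_
      rw [mul_mul_mul_comm, hd, mul_mul_mul_comm √_, hw1, upperInd_mul_self]
      ring
    · refine Finset.sum_eq_zero fun x _ => ?_
      rw [mul_mul_mul_comm, mul_mul_mul_comm _ (upperInd p q v x), upperInd_mul_upperInd hvw]
      simp
  · rw [← sum_upperInd_mul_lowerInd_div_degree hp hq]
    refine Finset.sum_congr rfl fun x _ => ?_
    rw [mul_mul_mul_comm, hd, mul_mul_mul_comm √_, hw, one_mul, mul_comm]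
  · rw [← sum_upperInd_mul_lowerInd_div_degree hp hq]
    refine Finset.sum_congr rfl fun x _ => ?_
    rw [mul_mul_mul_comm, hd, mul_mul_mul_comm √_, mul_comm √_, hw, one_mul, mul_comm,
      mul_comm (lowerInd _ _ _ _)]
  · split_ifs with hvw
    · subst hvw
      rw [← sum_lowerInd_div_degree hp hq v, Finset.mul_sum]
      refine Finset.sum_congr rfl fun x _ => ?_
      rw [mul_mul_mul_comm, hd, mul_mul_mul_comm √_, hw2, lowerInd_mul_self]
      ring
    · refine Finset.sum_eq_zero fun x _ => ?_
      rw [mul_mul_mul_comm, mul_mul_mul_comm _ (lowerInd p q v x), lowerInd_mul_lowerInd hvw]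
      simp

/-- The spectrum of the `(p, q)` ornamented `T` depends only on `T` and `p + q`: multiplying the two
factors of the normalized adjacency matrix in the other order gives the Gram matrix, with rows
permuted. -/
lemma normAdjSpectrum_ornamented {p' q' : ℕ} (hp : 1 ≤ p) (hq : 2 ≤ q) (hp' : 1 ≤ p')
    (hq' : 2 ≤ q') (h : p + q = p' + q') :
    normAdjSpectrum (T.ornamented p q) = normAdjSpectrum (T.ornamented p' q') := by
  classical
  have key {p q : ℕ} (hp : 1 ≤ p) (hq : 2 ≤ q) :
      Polynomial.X ^ (Fintype.card (T.Internal ⊕ T.Internal)) *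
        (normAdjMatrix (T.ornamented p q)).charpoly =
      Polynomial.X ^ (Nat.card (T.OrnVertex p q)) *
        ((T.gramMatrix ((p + q : ℕ) : ℝ)).submatrix Sum.swap id).charpoly := by
    have h : T.swappedBlockMatrix p q * T.blockMatrix p q =
        (T.gramMatrix ((p + q : ℕ) : ℝ)).submatrix Sum.swap id := by
      rw [← transpose_blockMatrix_mul hp hq]
      rfl
    rw [normAdjMatrix_ornamented hp hq, Matrix.charpoly_mul_comm', h, Nat.card_eq_fintype_card]
  have hcard : Nat.card (T.OrnVertex p q) = Nat.card (T.OrnVertex p' q') := by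
    rw [card_ornVertex, card_ornVertex]
    congr 2
    omega
  have h1 := key hp hq
  rw [hcard, h, ← key hp' hq'] at h1
  have h2 := mul_left_cancel₀ (pow_ne_zero _ Polynomial.X_ne_zero) h1
  rw [normAdjSpectrum, normAdjSpectrum]
  convert congrArg Polynomial.roots h2

end FullBinTree

/-! ### Isomorphism of rooted trees and swaps of children -/

namespace FullBinTree

/-- Two plane trees are related if one can be turned into the other by interchanging the left and
the right subtree at some of the vertices. -/
inductive SwapEquiv : FullBinTree → FullBinTree → Prop
  | leaf : SwapEquiv leaf leaf
  | node {l r l' r' : FullBinTree} (hl : SwapEquiv l l') (hr : SwapEquiv r r') :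
      SwapEquiv (node l r) (node l' r')
  | swap {l r l' r' : FullBinTree} (hl : SwapEquiv l r') (hr : SwapEquiv r l') :
      SwapEquiv (node l r) (node l' r')

variable {l r l' r' T T' : FullBinTree}

lemma relIso_root (e : IsChild (T := T) ≃r IsChild (T := T')) : e (.root T) = .root T' := by
  by_contra h
  obtain ⟨p, hp⟩ := exists_parent (e (.root T)) (mt depth_eq_zero.1 h)
  rw [← e.apply_symm_apply p, e.map_rel_iff] at hp
  exact absurd hp.depth_eq (by simp [depth])

/-- The map between vertex sets that is given by two maps between the subtrees at the root. -/
def nodeMap (f : l.Vertex → l'.Vertex) (g : r.Vertex → r'.Vertex) :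
    (node l r).Vertex → (node l' r').Vertex
  | .root _ => .root _
  | .left v => .left (f v)
  | .right v => .right (g v)

lemma isChild_nodeMap (e : IsChild (T := l) ≃r IsChild (T := l'))
    (f : IsChild (T := r) ≃r IsChild (T := r')) {v w : (node l r).Vertex} (h : IsChild v w) :
    IsChild (nodeMap e f v) (nodeMap e f w) := by
  cases h with
  | rootLeft => simpa [nodeMap, relIso_root] using .rootLeft
  | rootRight => simpa [nodeMap, relIso_root] using .rootRight
  | left h => exact .left (e.map_rel_iff.2 h)
  | right h => exact .right (f.map_rel_iff.2 h)

lemma Iso.node (hl : Iso l l') (hr : Iso r r') : Iso (node l r) (node l' r') := by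
  obtain ⟨e⟩ := hl
  obtain ⟨f⟩ := hr
  have h1 (v) : nodeMap e.symm f.symm (nodeMap e f v) = v := by cases v <;> simp [nodeMap]
  have h2 (v) : nodeMap e f (nodeMap e.symm f.symm v) = v := by cases v <;> simp [nodeMap]
  refine ⟨⟨⟨nodeMap e f, nodeMap e.symm f.symm, h1, h2⟩, fun {v w} => ⟨fun h => ?_,
    isChild_nodeMap e f⟩⟩⟩
  simpa [h1] using isChild_nodeMap e.symm f.symm h

/-- Interchanging the left and the right subtree at the root. -/
def mirror : (node l r).Vertex → (node r l).Vertex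
  | .root _ => .root _
  | .left v => .right v
  | .right v => .left v

lemma isChild_mirror {v w : (node l r).Vertex} (h : IsChild v w) :
    IsChild (mirror v) (mirror w) := by
  cases h with
  | rootLeft => exact .rootRight
  | rootRight => exact .rootLeft
  | left h => exact .right h
  | right h => exact .left h

lemma iso_mirror (l r : FullBinTree) : Iso (node l r) (node r l) := by
  have h (l r : FullBinTree) (v : (FullBinTree.node l r).Vertex) : mirror (mirror v) = v := by
    cases v <;> rfl
  refine ⟨⟨⟨mirror, mirror, h l r, h r l⟩, fun {v w} => ⟨fun h' => ?_, isChild_mirror⟩⟩⟩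
  simpa [h] using isChild_mirror h'

lemma SwapEquiv.iso (h : SwapEquiv T T') : Iso T T' := by
  induction h with
  | leaf => exact isoSetoid.refl _
  | node _ _ hl hr => exact hl.node hr
  | swap _ _ hl hr => exact isoSetoid.trans (iso_mirror _ _) (hr.node hl)

/-- The relation "is a child of" between the vertices that have children. -/
def InternalChild (T : FullBinTree) (v w : T.Internal) : Prop := IsChild v.1 w.1

/-- A leaf child is not seen by a bijection `e` between the vertices that have children, but their
number is, because every such vertex has exactly two children. -/
lemma swapEquiv_sub (e : T.InternalChild ≃r T'.InternalChild) (S : FullBinTree) (v : T.Internal)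
    (hv : sub v.1 = S) : SwapEquiv (sub v.1) (sub (e v).1) := by
  induction S generalizing v with
  | leaf => exact absurd v.2 ((sub_eq_leaf_iff _).1 hv)
  | node l r ihl ihr =>
    obtain ⟨a, b, hab, hvab, hsub⟩ := exists_children v
    obtain ⟨c, d, hcd, hecd, hesub⟩ := exists_children (e v)
    rw [hsub, node.injEq] at hv
    -- the image of a child with children is one of `c`, `d`
    have himg (x : T.Internal) (hx : x.1 = a ∨ x.1 = b) :
        ((e x).1 = c ∨ (e x).1 = d) ∧ SwapEquiv (sub x.1) (sub (e x).1) := by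
      refine ⟨(hecd _).1 (e.map_rel_iff.2 ((hvab _).2 hx)), ?_⟩
      rcases hx with hx | hx
      · exact ihl x (by rw [hx, hv.1])
      · exact ihr x (by rw [hx, hv.2])
    have hpre (y : T'.Internal) (hy : y.1 = c ∨ y.1 = d) :
        (e.symm y).1 = a ∨ (e.symm y).1 = b := by
      refine (hvab _).1 (e.map_rel_iff.1 ?_)
      simpa [InternalChild] using (hecd y.1).2 hy
    have leaf_of {z : T'.Vertex} (hz : z = c ∨ z = d)
        (h : ∀ x : T.Internal, x.1 = a ∨ x.1 = b → (e x).1 ≠ z) : sub z = leaf := by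
      rw [sub_eq_leaf_iff]
      intro hz'
      exact h _ (hpre ⟨z, hz'⟩ hz) (by simp)
    rw [hsub, hesub]
    by_cases ha : ∃ w, IsChild a w <;> by_cases hb : ∃ w, IsChild b w
    · obtain ⟨h1, h1'⟩ := himg ⟨a, ha⟩ (.inl rfl)
      obtain ⟨h2, h2'⟩ := himg ⟨b, hb⟩ (.inr rfl)
      have hne : (e ⟨a, ha⟩).1 ≠ (e ⟨b, hb⟩).1 := by
        intro h
        exact hab (Subtype.mk.inj (e.injective (Subtype.ext h)))
      rcases h1 with h1 | h1 <;> rcases h2 with h2 | h2 <;> rw [h1] at h1' <;> rw [h2] at h2'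
      · exact absurd (h1.trans h2.symm) hne
      · exact .node h1' h2'
      · exact .swap h1' h2'
      · exact absurd (h1.trans h2.symm) hne
    · obtain ⟨h1, h1'⟩ := himg ⟨a, ha⟩ (.inl rfl)
      have hx (x : T.Internal) (hx : x.1 = a ∨ x.1 = b) : x = ⟨a, ha⟩ := by
        rcases hx with hx | hx
        · exact Subtype.ext hx
        · exact absurd (hx ▸ x.2) hb
      rw [(sub_eq_leaf_iff b).2 hb]
      rcases h1 with h1 | h1 <;> rw [h1] at h1'
      · rw [leaf_of (z := d) (.inr rfl) fun x hx' => by rw [hx x hx', h1]; exact hcd]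
        exact .node h1' .leaf
      · rw [leaf_of (z := c) (.inl rfl) fun x hx' => by rw [hx x hx', h1]; exact hcd.symm]
        exact .swap h1' .leaf
    · obtain ⟨h1, h1'⟩ := himg ⟨b, hb⟩ (.inr rfl)
      have hx (x : T.Internal) (hx : x.1 = a ∨ x.1 = b) : x = ⟨b, hb⟩ := by
        rcases hx with hx | hx
        · exact absurd (hx ▸ x.2) ha
        · exact Subtype.ext hx
      rw [(sub_eq_leaf_iff a).2 ha]
      rcases h1 with h1 | h1 <;> rw [h1] at h1'
      · rw [leaf_of (z := d) (.inr rfl) fun x hx' => by rw [hx x hx', h1]; exact hcd]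
        exact .swap .leaf h1'
      · rw [leaf_of (z := c) (.inl rfl) fun x hx' => by rw [hx x hx', h1]; exact hcd.symm]
        exact .node .leaf h1'
    · have hx (x : T.Internal) (hx : x.1 = a ∨ x.1 = b) : False := by
        rcases hx with hx | hx
        · exact ha (hx ▸ x.2)
        · exact hb (hx ▸ x.2)
      rw [(sub_eq_leaf_iff a).2 ha, (sub_eq_leaf_iff b).2 hb,
        leaf_of (.inl rfl) fun x hx' => (hx x hx').elim,
        leaf_of (.inr rfl) fun x hx' => (hx x hx').elim]
      exact .node .leaf .leaf

lemma exists_internalChild_iff (v : T.Internal) :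
    (∃ u, T.InternalChild u v) ↔ v.1 ≠ .root T := by
  rw [← depth_eq_zero.ne]
  constructor
  · rintro ⟨u, hu⟩
    have := IsChild.depth_eq hu
    omega
  · intro h
    obtain ⟨u, hu⟩ := exists_parent v.1 h
    exact ⟨⟨u, _, hu⟩, hu⟩

lemma swapEquiv_of_internal (e : T.InternalChild ≃r T'.InternalChild) : SwapEquiv T T' := by
  have hroot (S : FullBinTree) (h : S ≠ leaf) : ∃ w, IsChild (.root S) w := by
    by_contra h'
    exact h ((sub_eq_leaf_iff (.root S)).2 h')
  have hleaf (S : FullBinTree) (v : S.Internal) : S ≠ leaf := by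
    rintro rfl
    obtain ⟨_, _, h⟩ := v
    cases h
  by_cases hT : T = leaf
  · have hT' : T' = leaf := by
      by_contra h
      exact hleaf T (e.symm ⟨_, hroot T' h⟩) hT
    rw [hT, hT']
    exact .leaf
  · have h := swapEquiv_sub e _ ⟨_, hroot T hT⟩ rfl
    have h' : (e ⟨_, hroot T hT⟩).1 = .root T' := by
      by_contra h'
      obtain ⟨u, hu⟩ := (exists_internalChild_iff _).2 h'
      rw [← e.apply_symm_apply u, e.map_rel_iff] at hu
      exact (exists_internalChild_iff _).1 ⟨_, hu⟩ rfl
    rwa [h'] at h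

/-- An isomorphism restricts to the vertices that have children. -/
lemma Iso.internal (h : Iso T T') : Nonempty (T.InternalChild ≃r T'.InternalChild) := by
  obtain ⟨e⟩ := h
  refine ⟨⟨e.toEquiv.subtypeEquiv fun v => ?_, e.map_rel_iff⟩⟩
  refine ⟨fun ⟨w, hw⟩ => ⟨e w, e.map_rel_iff.2 hw⟩, fun ⟨w, hw⟩ => ⟨e.symm w, ?_⟩⟩
  rw [← e.map_rel_iff, e.apply_symm_apply]
  exact hw

lemma iso_iff_swapEquiv : Iso T T' ↔ SwapEquiv T T' :=
  ⟨fun h => h.internal.elim swapEquiv_of_internal, SwapEquiv.iso⟩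

end FullBinTree

/-! ### Counting full binary trees -/

namespace FullBinTree

/-- The vertices with children of a full binary tree, as a binary tree. -/
def toBinaryTree : FullBinTree → BinaryTree Unit
  | leaf => .nil
  | node l r => .node () l.toBinaryTree r.toBinaryTree

/-- The full binary tree whose vertices with children form a given binary tree. -/
def ofBinaryTree : BinaryTree Unit → FullBinTree
  | .nil => leaf
  | .node _ l r => node (ofBinaryTree l) (ofBinaryTree r)

/-- Removing the leaves is a bijection from plane full binary trees to binary trees. -/
def equivBinaryTree : FullBinTree ≃ BinaryTree Unit where
  toFun := toBinaryTree
  invFun := ofBinaryTree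
  left_inv T := by
    induction T with
    | leaf => rfl
    | node l r hl hr => simp [toBinaryTree, ofBinaryTree, hl, hr]
  right_inv t := by
    induction t with
    | nil => rfl
    | node _ l r hl hr => simp [toBinaryTree, ofBinaryTree, hl, hr]

lemma numNodes_equivBinaryTree (T : FullBinTree) :
    (equivBinaryTree T).numNodes = T.numInternal := by
  change (T.toBinaryTree).numNodes = _
  induction T with
  | leaf => rfl
  | node l r hl hr =>
    simp [toBinaryTree, numInternal, BinaryTree.numNodes, hl, hr]

lemma card_vertex_eq_iff {T : FullBinTree} {k : ℕ} :
    Nat.card T.Vertex = 1 + 2 * k ↔ T.numInternal = k := by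
  rw [card_vertex]
  omega

lemma image_equivBinaryTree (k : ℕ) : equivBinaryTree '' {T | Nat.card T.Vertex = 1 + 2 * k} =
    BinaryTree.treesOfNumNodesEq k := by
  ext t
  rw [Equiv.image_eq_preimage_symm]
  simp only [Set.mem_preimage, Set.mem_ofPred_eq, card_vertex_eq_iff, Finset.mem_coe,
    BinaryTree.mem_treesOfNumNodesEq]
  rw [← numNodes_equivBinaryTree, Equiv.apply_symm_apply]

lemma ncard_trees (k : ℕ) :
    {T : FullBinTree | Nat.card T.Vertex = 1 + 2 * k}.ncard = catalan k := by
  rw [← Set.ncard_image_of_injective _ equivBinaryTree.injective, image_equivBinaryTree,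
    Set.ncard_coe_finset, BinaryTree.treesOfNumNodesEq_card_eq_catalan]

lemma finite_trees (k : ℕ) : {T : FullBinTree | Nat.card T.Vertex = 1 + 2 * k}.Finite := by
  rw [← Set.finite_image_iff equivBinaryTree.injective.injOn, image_equivBinaryTree]
  exact Finset.finite_toSet _

/-- A swap equivalence class consists of the trees that arise from independent choices at the
vertices with children; the choice at a lowest such vertex has no effect. -/
lemma ncard_swapEquiv_le (T : FullBinTree) :
    {T' | SwapEquiv T T'}.Finite ∧ {T' | SwapEquiv T T'}.ncard ≤ 2 ^ (T.numInternal - 1) := by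
  induction T with
  | leaf =>
    have h : {T' | SwapEquiv leaf T'} = {leaf} := by
      ext T'
      refine ⟨fun h => ?_, ?_⟩
      · cases h; rfl
      · rintro rfl; exact .leaf
    simp [h, numInternal]
  | node l r hl hr =>
    obtain ⟨hlf, hl⟩ := hl
    obtain ⟨hrf, hr⟩ := hr
    set A := {T' | SwapEquiv l T'}
    set B := {T' | SwapEquiv r T'}
    have hsub : {T' | SwapEquiv (node l r) T'} ⊆
        (fun x : FullBinTree × FullBinTree => node x.1 x.2) '' (A ×ˢ B) ∪
        (fun x : FullBinTree × FullBinTree => node x.1 x.2) '' (B ×ˢ A) := by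
      intro T' h
      cases h with
      | node hl hr => exact .inl ⟨(_, _), ⟨hl, hr⟩, rfl⟩
      | swap hl hr => exact .inr ⟨(_, _), ⟨hr, hl⟩, rfl⟩
    have h1 := ((hlf.prod hrf).image fun x : FullBinTree × FullBinTree => node x.1 x.2)
    have h2 := ((hrf.prod hlf).image fun x : FullBinTree × FullBinTree => node x.1 x.2)
    refine ⟨(h1.union h2).subset hsub, ?_⟩
    have hn1 : ((fun x : FullBinTree × FullBinTree => node x.1 x.2) '' (A ×ˢ B)).ncard ≤
        2 ^ (l.numInternal - 1) * 2 ^ (r.numInternal - 1) :=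
      (Set.ncard_image_le (hlf.prod hrf)).trans (by rw [Set.ncard_prod]; exact mul_le_mul' hl hr)
    have hn2 : ((fun x : FullBinTree × FullBinTree => node x.1 x.2) '' (B ×ˢ A)).ncard ≤
        2 ^ (l.numInternal - 1) * 2 ^ (r.numInternal - 1) :=
      (Set.ncard_image_le (hrf.prod hlf)).trans
        (by rw [Set.ncard_prod, mul_comm]; exact mul_le_mul' hl hr)
    rw [← pow_add] at hn1 hn2
    by_cases hlr : l = leaf ∧ r = leaf
    · obtain ⟨rfl, rfl⟩ := hlr
      have h : {T' | SwapEquiv (node leaf leaf) T'} ⊆ {node leaf leaf} := by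
        intro T' h
        cases h with
        | node hl hr => cases hl; cases hr; rfl
        | swap hl hr => cases hl; cases hr; rfl
      simpa [numInternal] using Set.ncard_le_ncard h
    · have hpos : l.numInternal - 1 + (r.numInternal - 1) + 1 ≤ (node l r).numInternal - 1 := by
        have : l.numInternal ≠ 0 ∨ r.numInternal ≠ 0 := by
          by_contra h
          push Not at h
          refine hlr ⟨?_, ?_⟩
          · cases l with
            | leaf => rfl
            | node => simp [numInternal] at h
          · cases r with
            | leaf => rfl
            | node => simp [numInternal] at h
        simp only [numInternal]
        omega
      calc _ ≤ _ := Set.ncard_le_ncard hsub (h1.union h2)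
        _ ≤ _ := Set.ncard_union_le _ _
        _ ≤ 2 ^ (l.numInternal - 1 + (r.numInternal - 1)) +
            2 ^ (l.numInternal - 1 + (r.numInternal - 1)) := add_le_add hn1 hn2
        _ = 2 ^ (l.numInternal - 1 + (r.numInternal - 1) + 1) := by ring
        _ ≤ _ := Nat.pow_le_pow_right (by norm_num) hpos

lemma catalan_le_numIsoClasses (k : ℕ) :
    catalan k ≤ 2 ^ (k - 1) * numIsoClasses (1 + 2 * k) := by
  classical
  have hf := finite_trees k
  rw [← ncard_trees, numIsoClasses, Set.ncard_eq_toFinset_card _ hf,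
    Set.ncard_eq_toFinset_card _ (hf.image _), mul_comm (2 ^ _)]
  have hmaps : ∀ T ∈ hf.toFinset,
      Quotient.mk isoSetoid T ∈ (hf.image (Quotient.mk isoSetoid)).toFinset := by
    intro T hT
    rw [Set.Finite.mem_toFinset] at hT ⊢
    exact ⟨T, hT, rfl⟩
  rw [Finset.card_eq_sum_card_fiberwise hmaps]
  refine (Finset.sum_le_card_nsmul _ _ (2 ^ (k - 1)) fun c hc => ?_).trans_eq (smul_eq_mul _ _)
  rw [Set.Finite.mem_toFinset] at hc
  obtain ⟨T, hT, rfl⟩ := hc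
  obtain ⟨hfin, hle⟩ := ncard_swapEquiv_le T
  rw [card_vertex_eq_iff.1 hT] at hle
  rw [← Set.ncard_coe_finset]
  refine (Set.ncard_le_ncard (fun T' hT' => ?_) hfin).trans hle
  exact iso_iff_swapEquiv.1 (isoSetoid.symm (Quotient.exact (Finset.mem_filter.1 hT').2))

/-- The number of full binary trees up to isomorphism grows at least like `2 ^ k / k ^ 2`. -/
lemma eventually_pow_le_numIsoClasses :
    ∀ᶠ k : ℕ in Filter.atTop, (3 / 2 : ℝ) ^ k ≤ numIsoClasses (1 + 2 * k) := by
  have hlim := tendsto_pow_const_div_const_pow_of_one_lt 2 (show (1 : ℝ) < 4 / 3 by norm_num)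
  filter_upwards [hlim.eventually_lt_const (show (0 : ℝ) < 1 by norm_num),
    Filter.eventually_ge_atTop 4] with k hk h4
  rw [div_lt_one (by positivity)] at hk
  have h1 := Nat.four_pow_lt_mul_centralBinom k h4
  rw [← succ_mul_catalan_eq_centralBinom] at h1
  have h2 := catalan_le_numIsoClasses k
  have h3 : (4 : ℝ) ^ k < k * ((k + 1) * catalan k) := by exact_mod_cast h1
  have h5 : (catalan k : ℝ) ≤ 2 ^ (k - 1) * numIsoClasses (1 + 2 * k) := by exact_mod_cast h2
  have h6 : (2 : ℝ) ^ k = 2 * 2 ^ (k - 1) := by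
    rw [← pow_succ', Nat.sub_add_cancel (by omega)]
  set b : ℝ := ((numIsoClasses (1 + 2 * k) : ℕ) : ℝ)
  have hk4 : (4 : ℝ) ≤ k := by exact_mod_cast h4
  -- `4 ^ k < k (k + 1) C_k ≤ k ^ 2 * 2 ^ k * b`, where `k ^ 2 < (4 / 3) ^ k`
  have h7 : (4 : ℝ) ^ k < k ^ 2 * 2 ^ k * b := by
    calc (4 : ℝ) ^ k < k * ((k + 1) * catalan k) := h3
      _ ≤ k * ((2 * k) * (2 ^ (k - 1) * b)) := by gcongr; linarith
      _ = k ^ 2 * 2 ^ k * b := by rw [h6]; ring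
  have h8 : (4 : ℝ) ^ k ≤ (4 / 3) ^ k * 2 ^ k * b := by
    refine h7.le.trans ?_
    gcongr
  rw [← mul_pow] at h8
  have h9 : (4 : ℝ) ^ k = (4 / 3 * 2) ^ k * (3 / 2) ^ k := by rw [← mul_pow]; norm_num
  rw [h9] at h8
  exact le_of_mul_le_mul_left h8 (by positivity)

end FullBinTree

/-! ### Rigidity of rooted trees -/

section Rigidity

/-- `C v w` says that `w` is a child of `v` in a rooted tree in which `w` has distance `d w` from
the root. -/
structure IsRootedTree {I : Type*} (C : I → I → Prop) (d : I → ℕ) : Prop where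
  depth_eq {v w : I} : C v w → d w = d v + 1
  unique {v v' w : I} : C v w → C v' w → v = v'
  exists_parent {v : I} : d v ≠ 0 → ∃ u, C u v
  root_unique {v w : I} : d v = 0 → d w = 0 → v = w

/-- A bijection between the vertices of two rooted trees that matches the roots and, between all
other vertices, preserves adjacency and the relation of having a common parent. Whether a vertex
is adjacent to the root need not be preserved, nor which of two adjacent vertices is the parent. -/
structure PreservesSiblings {I I' : Type*} (C : I → I → Prop) (d : I → ℕ) (C' : I' → I' → Prop)
    (d' : I' → ℕ) (e : I ≃ I') : Prop where
  root (v : I) : d v = 0 ↔ d' (e v) = 0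
  adj {v w : I} : d v ≠ 0 → d w ≠ 0 → (C v w ∨ C w v ↔ C' (e v) (e w) ∨ C' (e w) (e v))
  sib {v w : I} : d v ≠ 0 → d w ≠ 0 →
    ((∃ u, C u v ∧ C u w) ↔ ∃ u, C' u (e v) ∧ C' u (e w))

variable {I I' : Type*} {C : I → I → Prop} {d : I → ℕ} {C' : I' → I' → Prop} {d' : I' → ℕ}
  {e : I ≃ I'} {s t u : I}

lemma PreservesSiblings.symm (h : PreservesSiblings C d C' d' e) :
    PreservesSiblings C' d' C d e.symm where
  root v := by rw [h.root, e.apply_symm_apply]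
  adj {v w} hv hw := by
    rw [← e.apply_symm_apply v, ne_eq, ← h.root] at hv
    rw [← e.apply_symm_apply w, ne_eq, ← h.root] at hw
    simpa using (h.adj hv hw).symm
  sib {v w} hv hw := by
    rw [← e.apply_symm_apply v, ne_eq, ← h.root] at hv
    rw [← e.apply_symm_apply w, ne_eq, ← h.root] at hw
    simpa using (h.sib hv hw).symm

/-- The parent `s`, not the root, and its child `t` change their roles under `e`. -/
def Flipped (C : I → I → Prop) (d : I → ℕ) (C' : I' → I' → Prop) (e : I ≃ I') (s t : I) : Prop :=
  d s ≠ 0 ∧ C s t ∧ C' (e t) (e s)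

lemma Flipped.only_child (hC : IsRootedTree C d) (hC' : IsRootedTree C' d')
    (h : PreservesSiblings C d C' d' e) (hf : Flipped C d C' e s t) (hu : C s u) : u = t := by
  obtain ⟨hs, hst, hf⟩ := hf
  have ht := hC.depth_eq hst
  have hu' := hC.depth_eq hu
  obtain ⟨x, hx, hx'⟩ := (h.sib (by omega) (by omega)).1 ⟨s, hst, hu⟩
  have := hC'.depth_eq hx
  have := hC'.depth_eq hx'
  have := hC'.depth_eq hf
  rcases (h.adj hs (by omega)).1 (.inl hu) with h1 | h1
  · have := hC'.depth_eq h1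
    omega
  · exact e.injective (hC'.unique h1 hf)

lemma Flipped.up (hC : IsRootedTree C d) (hC' : IsRootedTree C' d')
    (h : PreservesSiblings C d C' d' e) (hf : Flipped C d C' e s t) (hu : C u s) (hu0 : d u ≠ 0) :
    Flipped C d C' e u s := by
  obtain ⟨hs, hst, hf⟩ := hf
  refine ⟨hu0, hu, ?_⟩
  rcases (h.adj hu0 hs).1 (.inl hu) with h1 | h1
  · have := e.injective (hC'.unique h1 hf)
    have := hC.depth_eq hst
    have := hC.depth_eq hu
    subst_vars
    omega
  · exact h1

lemma Flipped.down (hC : IsRootedTree C d) (h : PreservesSiblings C d C' d' e)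
    (hf : Flipped C d C' e s t) (hu : C t u) : Flipped C d C' e t u := by
  obtain ⟨hs, hst, hf⟩ := hf
  have ht := hC.depth_eq hst
  have hu' := hC.depth_eq hu
  refine ⟨by omega, hu, ?_⟩
  rcases (h.adj (by omega) (by omega)).1 (.inl hu) with h1 | h1
  · obtain ⟨x, hx, hx'⟩ := (h.sib hs (by omega)).2 ⟨_, hf, h1⟩
    have := hC.depth_eq hx
    have := hC.depth_eq hx'
    omega
  · exact h1

lemma Flipped.only_top (hC : IsRootedTree C d) (hC' : IsRootedTree C' d')
    (h : PreservesSiblings C d C' d' e) (hf : Flipped C d C' e s t) (hs1 : d s = 1) (hu : d u = 1) :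
    u = s := by
  obtain ⟨hs, hst, hf⟩ := hf
  have ht := hC.depth_eq hst
  obtain ⟨r, hr⟩ := hC.exists_parent hs
  obtain ⟨r', hr'⟩ := hC.exists_parent (v := u) (by omega)
  have := hC.depth_eq hr
  have := hC.depth_eq hr'
  obtain rfl := hC.root_unique (v := r) (w := r') (by omega) (by omega)
  obtain ⟨x, hx, hx'⟩ := (h.sib hs (by omega)).1 ⟨r, hr, hr'⟩
  obtain rfl := hC'.unique hx hf
  rcases (h.adj (by omega) (by omega)).2 (.inl hx') with h1 | h1
  · have := hC.depth_eq h1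
    omega
  · exact hC.unique h1 hst

lemma Flipped.exists_top (hC : IsRootedTree C d) (hC' : IsRootedTree C' d')
    (h : PreservesSiblings C d C' d' e) (hf : Flipped C d C' e s t) :
    ∃ a b, d a = 1 ∧ Flipped C d C' e a b := by
  induction hn : d s generalizing s t with
  | zero => exact absurd hn hf.1
  | succ n ih =>
    obtain ⟨u, hu⟩ := hC.exists_parent hf.1
    have hd := hC.depth_eq hu
    by_cases hu0 : d u = 0
    · exact ⟨s, t, by omega, hf⟩
    · exact ih (hf.up hC hC' h hu hu0) (by omega)

/-- If one edge is flipped, then all edges below the root are, and the tree is a chain. -/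
lemma Flipped.depth_injective (hC : IsRootedTree C d) (hC' : IsRootedTree C' d')
    (h : PreservesSiblings C d C' d' e) (hf : Flipped C d C' e s t) : Function.Injective d := by
  obtain ⟨a, b, ha, hab⟩ := hf.exists_top hC hC' h
  have key (n : ℕ) : ∀ v, d v = n + 1 →
      (∀ w, d w = n + 1 → w = v) ∧ ∀ w, C v w → Flipped C d C' e v w := by
    induction n with
    | zero =>
      intro v hv
      obtain rfl := hab.only_top hC hC' h ha hv
      refine ⟨fun w hw => hab.only_top hC hC' h ha hw, fun w hw => ?_⟩
      rwa [hab.only_child hC hC' h hw]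
    | succ n ih =>
      intro v hv
      obtain ⟨p, hp⟩ := hC.exists_parent (v := v) (by omega)
      have hpd := hC.depth_eq hp
      obtain ⟨h1, h2⟩ := ih p (by omega)
      refine ⟨fun w hw => ?_, fun w hw => (h2 v hp).down hC h hw⟩
      obtain ⟨p', hp'⟩ := hC.exists_parent (v := w) (by omega)
      have hpd' := hC.depth_eq hp'
      obtain rfl := h1 p' (by omega)
      exact (h2 v hp).only_child hC hC' h hp'
  intro v w hvw
  rcases hd : d v with _ | n
  · exact hC.root_unique hd (hvw ▸ hd)
  · exact (key n w (hvw ▸ hd)).1 v hd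

/-- If no edge is flipped, then the bijection is an isomorphism. -/
lemma PreservesSiblings.map_child (hC : IsRootedTree C d) (hC' : IsRootedTree C' d')
    (h : PreservesSiblings C d C' d' e) (hf : ∀ s t, ¬ Flipped C d C' e s t) {v w : I}
    (hvw : C v w) : C' (e v) (e w) := by
  have hwd := hC.depth_eq hvw
  have hpos {v w : I} (hv : d v ≠ 0) (hvw : C v w) : C' (e v) (e w) := by
    have hwd := hC.depth_eq hvw
    refine ((h.adj hv (by omega)).1 (.inl hvw)).resolve_right fun h' => hf v w ⟨hv, hvw, h'⟩
  by_cases hv : d v = 0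
  · obtain ⟨y, hy⟩ := hC'.exists_parent (v := e w) (by rw [ne_eq, ← h.root]; omega)
    obtain ⟨p, rfl⟩ := e.surjective y
    by_cases hp : d p = 0
    · rwa [hC.root_unique hv hp]
    · rcases (h.adj hp (by omega)).2 (.inl hy) with h1 | h1
      · rw [hC.unique h1 hvw] at hp
        exact absurd hv hp
      · have := hC'.depth_eq (hpos (by omega) h1)
        have := hC'.depth_eq hy
        omega
  · exact hpos hv hvw

lemma Finset.eq_range_of_lower {s : Finset ℕ} (h : ∀ n, n + 1 ∈ s → n ∈ s) :
    s = Finset.range s.card := by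
  have hle (n : ℕ) (hn : n ∈ s) : Finset.range (n + 1) ⊆ s := by
    induction n with
    | zero => simpa using hn
    | succ n ih =>
      rw [Finset.range_add_one, Finset.insert_subset_iff]
      exact ⟨hn, ih (h n hn)⟩
  refine Finset.eq_of_subset_of_card_le (fun n hn => ?_) (by simp)
  have := Finset.card_le_card (hle n hn)
  rw [Finset.card_range] at this
  exact Finset.mem_range.2 this

lemma IsRootedTree.image_depth [Fintype I] (hC : IsRootedTree C d) (hd : Function.Injective d) :
    Finset.univ.image d = Finset.range (Fintype.card I) := by
  rw [Finset.eq_range_of_lower (s := Finset.univ.image d), Finset.card_image_of_injective _ hd,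
    Finset.card_univ]
  intro n hn
  obtain ⟨v, -, hv⟩ := Finset.mem_image.1 hn
  obtain ⟨u, hu⟩ := hC.exists_parent (v := v) (by omega)
  have := hC.depth_eq hu
  exact Finset.mem_image.2 ⟨u, Finset.mem_univ _, by omega⟩

lemma IsRootedTree.child_iff (hC : IsRootedTree C d) (hd : Function.Injective d) {v w : I} :
    C v w ↔ d w = d v + 1 := by
  refine ⟨hC.depth_eq, fun h => ?_⟩
  obtain ⟨u, hu⟩ := hC.exists_parent (v := w) (by omega)
  have := hC.depth_eq hu
  rwa [hd (show d v = d u by omega)]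

/-- Two chains of the same size are isomorphic. -/
lemma IsRootedTree.nonempty_relIso_of_injective [Finite I] (hC : IsRootedTree C d)
    (hC' : IsRootedTree C' d') (hd : Function.Injective d) (hd' : Function.Injective d')
    (e : I ≃ I') : Nonempty (C ≃r C') := by
  have := Fintype.ofFinite I
  have := Fintype.ofEquiv I e
  have him : Finset.univ.image d = Finset.univ.image d' := by
    rw [hC.image_depth hd, hC'.image_depth hd', Fintype.card_congr e]
  have h1 (v : I) : ∃ w, d' w = d v := by
    have : d v ∈ Finset.univ.image d' := him ▸ Finset.mem_image_of_mem _ (Finset.mem_univ v)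
    simpa using this
  have h2 (w : I') : ∃ v, d v = d' w := by
    have : d' w ∈ Finset.univ.image d := him ▸ Finset.mem_image_of_mem _ (Finset.mem_univ w)
    simpa using this
  choose f hf using h1
  choose g hg using h2
  refine ⟨⟨⟨f, g, fun v => hd (by rw [hg, hf]), fun w => hd' (by rw [hf, hg])⟩, fun {v w} => ?_⟩⟩
  change C' (f v) (f w) ↔ C v w
  rw [hC.child_iff hd, hC'.child_iff hd', hf, hf]

/-- A finite rooted tree is determined up to isomorphism by adjacency and siblings among the
vertices other than the root: a bijection that preserves these is an isomorphism, or turns one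
chain upside down to another. -/
theorem PreservesSiblings.nonempty_relIso [Finite I] (hC : IsRootedTree C d)
    (hC' : IsRootedTree C' d') (h : PreservesSiblings C d C' d' e) : Nonempty (C ≃r C') := by
  by_cases hf : ∃ s t, Flipped C d C' e s t
  · obtain ⟨s, t, hf⟩ := hf
    have hf' : Flipped C' d' C e.symm (e t) (e s) := by
      refine ⟨?_, hf.2.2, by simpa using hf.2.1⟩
      have := hC.depth_eq hf.2.1
      rw [ne_eq, ← h.root]
      omega
    exact hC.nonempty_relIso_of_injective hC' (hf.depth_injective hC hC' h)
      (hf'.depth_injective hC' hC h.symm) e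
  · push Not at hf
    refine ⟨⟨e, fun {v w} => ⟨fun hvw => ?_, h.map_child hC hC' hf⟩⟩⟩
    have hwd := hC'.depth_eq hvw
    obtain ⟨p, hp⟩ := hC.exists_parent (v := w) (by rw [ne_eq, h.root]; omega)
    rwa [e.injective (hC'.unique hvw (h.map_child hC hC' hf hp))]

end Rigidity

/-! ### Isomorphisms of ornamented trees -/

namespace FullBinTree

variable {T T' : FullBinTree} {p q : ℕ}

/-- Isomorphic rooted trees have isomorphic ornamented trees. -/
lemma Iso.ornamented (h : Iso T T') (p q : ℕ) :
    Nonempty (T.ornamented p q ≃g T'.ornamented p q) := by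
  obtain ⟨e⟩ := h
  have hint (v : T.Vertex) : (∃ w, IsChild v w) ↔ ∃ w, IsChild (e v) w :=
    ⟨fun ⟨w, hw⟩ => ⟨e w, e.map_rel_iff.2 hw⟩,
      fun ⟨w, hw⟩ => ⟨e.symm w, by rwa [← e.map_rel_iff, e.apply_symm_apply]⟩⟩
  let f : T.Internal ≃ T'.Internal := e.toEquiv.subtypeEquiv hint
  let F : T.OrnVertex p q ≃ T'.OrnVertex p q :=
    Equiv.sumCongr e.toEquiv (Equiv.prodCongr f (Equiv.refl _))
  have hup (v : T.Internal) (x : T.OrnVertex p q) :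
      InUpperPart (f v) (F x) ↔ InUpperPart v x := by
    rcases x with u | ⟨u, i | i⟩
    · exact e.injective.eq_iff
    · exact f.injective.eq_iff
    · exact Iff.rfl
  have hlow (v : T.Internal) (x : T.OrnVertex p q) :
      InLowerPart (f v) (F x) ↔ InLowerPart v x := by
    rcases x with u | ⟨u, i | i⟩
    · exact e.map_rel_iff
    · exact Iff.rfl
    · exact f.injective.eq_iff
  refine ⟨⟨F, fun {x y} => ?_⟩⟩
  simp_rw [ornamented_adj, ← f.exists_congr_right, hup, hlow]

lemma isRootedTree_internalChild (T : FullBinTree) :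
    IsRootedTree T.InternalChild fun v => depth v.1 where
  depth_eq h := IsChild.depth_eq h
  unique h h' := Subtype.ext (IsChild.unique h h')
  exists_parent {v} h := by
    obtain ⟨u, hu⟩ := exists_parent v.1 h
    exact ⟨⟨u, _, hu⟩, hu⟩
  root_unique {v w} hv hw := Subtype.ext ((depth_eq_zero.1 hv).trans (depth_eq_zero.1 hw).symm)

lemma ornamented_adj_inl {u w : T.Vertex} :
    (T.ornamented p q).Adj (.inl u) (.inl w) ↔ IsChild u w ∨ IsChild w u := by
  refine ⟨fun h => ?_, ?_⟩
  · obtain ⟨v, ⟨h1, h2⟩ | ⟨h1, h2⟩⟩ := ornamented_adj.1 h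
    · rw [show u = v.1 from h1]
      exact .inl h2
    · rw [show w = v.1 from h2]
      exact .inr h1
  · rintro (h | h)
    exacts [ornamented_adj_of_isChild h, (ornamented_adj_of_isChild h).symm]

/-- If every upper part has a second vertex, then two vertices with children are siblings if and
only if they have more than one common neighbour. -/
lemma isChild_isChild_iff (hp : 2 ≤ p) {v w : T.Internal} (hvw : v ≠ w) :
    (∃ u, T.InternalChild u v ∧ T.InternalChild u w) ↔
      ∃ x y, x ≠ y ∧ ((T.ornamented p q).Adj (.inl v.1) x ∧ (T.ornamented p q).Adj (.inl v.1) y) ∧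
        (T.ornamented p q).Adj (.inl w.1) x ∧ (T.ornamented p q).Adj (.inl w.1) y := by
  constructor
  · rintro ⟨u, hv, hw⟩
    exact ⟨.inl u.1, .inr (u, .inl ⟨0, by omega⟩), by simp,
      ⟨(ornamented_adj_of_isChild hv).symm, (ornamented_adj_upper_of_isChild u _ hv).symm⟩,
      (ornamented_adj_of_isChild hw).symm, (ornamented_adj_upper_of_isChild u _ hw).symm⟩
  · have hself {v a : T.Internal} (h : InUpperPart a (.inl v.1 : T.OrnVertex p q)) : a = v :=
      Subtype.ext (show v.1 = a.1 from h).symm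
    -- a common neighbour is above both vertices only if they are siblings, and never below both;
    -- above one and below the other, it is the parent of the one
    have key {v w : T.Internal} {x : T.OrnVertex p q} (hvw : v ≠ w)
        (hv : (T.ornamented p q).Adj (.inl v.1) x) (hw : (T.ornamented p q).Adj (.inl w.1) x) :
        (∃ u, T.InternalChild u v ∧ T.InternalChild u w) ∨
        (∃ u, T.InternalChild u v ∧ x = .inl u.1 ∧ depth v.1 = depth w.1 + 2) ∨
        (∃ u, T.InternalChild u w ∧ x = .inl u.1 ∧ depth w.1 = depth v.1 + 2) := by
      obtain ⟨a, ⟨hav, hax⟩ | ⟨hav, hax⟩⟩ := ornamented_adj.1 hv <;>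
        obtain ⟨b, ⟨hbw, hbx⟩ | ⟨hbw, hbx⟩⟩ := ornamented_adj.1 hw
      · exact absurd ((hself hav).symm.trans ((hax.unique hbx).trans (hself hbw))) hvw
      · obtain rfl := hself hav
        refine .inr (.inr ⟨b, hbw, eq_inl_of_upper_of_lower hbx hax, ?_⟩)
        have := hax.level_eq
        have := hbx.level_eq
        have := IsChild.depth_eq (show IsChild b.1 w.1 from hbw)
        omega
      · obtain rfl := hself hbw
        refine .inr (.inl ⟨a, hav, eq_inl_of_upper_of_lower hax hbx, ?_⟩)
        have := hax.level_eq
        have := hbx.level_eq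
        have := IsChild.depth_eq (show IsChild a.1 v.1 from hav)
        omega
      · obtain rfl := hax.unique hbx
        exact .inl ⟨a, hav, hbw⟩
    rintro ⟨x, y, hxy, ⟨hvx, hvy⟩, hwx, hwy⟩
    rcases key hvw hvx hwx with h | ⟨u, hu, rfl, h⟩ | ⟨u, hu, rfl, h⟩
    · exact h
    · rcases key hvw hvy hwy with h' | ⟨u', hu', rfl, h'⟩ | ⟨u', hu', rfl, h'⟩
      · exact h'
      · exact absurd (by rw [IsChild.unique hu hu']) hxy
      · omega
    · rcases key hvw hvy hwy with h' | ⟨u', hu', rfl, h'⟩ | ⟨u', hu', rfl, h'⟩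
      · exact h'
      · omega
      · exact absurd (by rw [IsChild.unique hu hu']) hxy

/-- The vertices with children other than the root are the vertices in two blocks, and they are
recognized by their degrees. -/
lemma degree_eq_add_iff (hp : 1 ≤ p) (hq : 2 ≤ q) (x : T.OrnVertex p q)
    [Fintype ((T.ornamented p q).neighborSet x)] :
    (T.ornamented p q).degree x = q + p ↔ ∃ v : T.Internal, depth v.1 ≠ 0 ∧ x = .inl v.1 := by
  classical
  rcases x with u | ⟨u, i | i⟩
  · rw [degree_inl hp hq]
    by_cases h1 : ∃ w, IsChild u w
    · by_cases h2 : u = .root T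
      · simp only [h2, if_true]
        rw [if_pos (h2 ▸ h1)]
        refine ⟨fun h => by omega, ?_⟩
        rintro ⟨v, hv, h⟩
        rw [← Sum.inl_injective h] at hv
        exact absurd rfl hv
      · simp only [h1, h2, if_true, if_false, true_iff]
        exact ⟨⟨u, h1⟩, mt depth_eq_zero.1 h2, rfl⟩
    · rw [if_neg h1]
      refine ⟨fun h => by split_ifs at h <;> omega, ?_⟩
      rintro ⟨v, -, h⟩
      exact absurd (Sum.inl_injective h ▸ v.2) h1
  · rw [degree_upper hp hq]
    simp
    omega
  · rw [degree_lower hp hq]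
    simp
    omega

/-- An isomorphism of ornamented trees induces a bijection between the vertices with children other
than the root that preserves adjacency and siblings, so the underlying rooted trees are
isomorphic. -/
lemma iso_of_ornamented_iso (hp : 2 ≤ p) (hq : 2 ≤ q)
    (φ : T.ornamented p q ≃g T'.ornamented p q) : Iso T T' := by
  classical
  have hnum : T.numInternal = T'.numInternal := by
    have := Nat.card_congr φ.toEquiv
    rw [card_ornVertex, card_ornVertex] at this
    exact Nat.eq_of_mul_eq_mul_right (show 0 < p - 1 + (q - 2) + 2 by omega) (by omega)
  have hcard : Nat.card T.Internal = Nat.card T'.Internal := by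
    rw [card_internal, card_internal, hnum]
  have himg (v : T.Internal) : ∃ w : T'.Internal, (depth v.1 = 0 ∧ depth w.1 = 0) ∨
      (depth v.1 ≠ 0 ∧ depth w.1 ≠ 0 ∧ φ (.inl v.1) = .inl w.1) := by
    by_cases hv : depth v.1 = 0
    · have : Nonempty T'.Internal := by
        have : Nonempty T.Internal := ⟨v⟩
        rw [← Finite.card_pos_iff, ← hcard]
        exact Finite.card_pos
      obtain ⟨w⟩ := this
      refine ⟨⟨.root T', ?_⟩, .inl ⟨hv, depth_eq_zero.2 rfl⟩⟩
      by_contra h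
      cases T' with
      | leaf =>
        obtain ⟨_, _, hw⟩ := w
        cases hw
      | node l r => exact h ⟨_, .rootLeft⟩
    · have h := (degree_eq_add_iff (by omega) hq (.inl v.1 : T.OrnVertex p q)).2 ⟨v, hv, rfl⟩
      rw [← φ.degree_eq] at h
      obtain ⟨w, hw, hw'⟩ := (degree_eq_add_iff (by omega) hq _).1 h
      exact ⟨w, .inr ⟨hv, hw, hw'⟩⟩
  choose f hf using himg
  have hinj : Function.Injective f := by
    intro v w hvw
    have h1 := hf v
    have h2 := hf w
    rw [← hvw] at h2
    rcases h1 with ⟨h1, h1'⟩ | ⟨h1, h1', h1''⟩ <;> rcases h2 with ⟨h2, h2'⟩ | ⟨h2, h2', h2''⟩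
    · exact (isRootedTree_internalChild T).root_unique h1 h2
    · exact absurd h1' h2'
    · exact absurd h2' h1'
    · exact Subtype.ext (Sum.inl_injective (φ.injective (h1''.trans h2''.symm)))
  let e : T.Internal ≃ T'.Internal :=
    Equiv.ofBijective f ((Nat.bijective_iff_injective_and_card f).2 ⟨hinj, hcard⟩)
  have he (v : T.Internal) (hv : depth v.1 ≠ 0) :
      depth (e v).1 ≠ 0 ∧ (.inl (e v).1 : T'.OrnVertex p q) = φ (.inl v.1) := by
    rcases hf v with h | ⟨-, h, h'⟩
    exacts [absurd h.1 hv, ⟨h, h'.symm⟩]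
  have hpres : PreservesSiblings T.InternalChild (fun v => depth v.1) T'.InternalChild
      (fun v => depth v.1) e := by
    refine ⟨fun v => ?_, fun {v w} hv hw => ?_, fun {v w} hv hw => ?_⟩
    · rcases hf v with h | h
      exacts [iff_of_true h.1 h.2, iff_of_false h.1 h.2.1]
    · have := φ.map_adj_iff (v := .inl v.1) (w := .inl w.1)
      rw [← (he v hv).2, ← (he w hw).2, ornamented_adj_inl, ornamented_adj_inl] at this
      exact this.symm
    · by_cases hvw : v = w
      · subst hvw
        obtain ⟨u, hu⟩ := (isRootedTree_internalChild T).exists_parent hv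
        obtain ⟨u', hu'⟩ := (isRootedTree_internalChild T').exists_parent (he v hv).1
        exact iff_of_true ⟨u, hu, hu⟩ ⟨u', hu', hu'⟩
      · rw [isChild_isChild_iff (q := q) hp hvw,
          isChild_isChild_iff (q := q) hp (e.injective.ne hvw), (he v hv).2, (he w hw).2]
        constructor
        · rintro ⟨x, y, hxy, h⟩
          exact ⟨φ x, φ y, φ.injective.ne hxy, by simpa only [φ.map_adj_iff] using h⟩
        · rintro ⟨x, y, hxy, h⟩
          obtain ⟨x, rfl⟩ := φ.surjective x
          obtain ⟨y, rfl⟩ := φ.surjective y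
          exact ⟨x, y, fun h => hxy (by rw [h]), by simpa only [φ.map_adj_iff] using h⟩
  obtain ⟨E⟩ := hpres.nonempty_relIso (isRootedTree_internalChild T)
    (isRootedTree_internalChild T')
  exact (swapEquiv_of_internal E).iso

lemma ornamented_iso_iff (hp : 2 ≤ p) (hq : 2 ≤ q) :
    Nonempty (T.ornamented p q ≃g T'.ornamented p q) ↔ Iso T T' :=
  ⟨fun ⟨φ⟩ => iso_of_ornamented_iso hp hq φ, fun h => h.ornamented p q⟩

end FullBinTree

/-! ### Spectral faux trees -/

lemma NoIsolatedVertices.of_iso {V W : Type*} {G : SimpleGraph V} {G' : SimpleGraph W}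
    (e : G ≃g G') (h : NoIsolatedVertices G) : NoIsolatedVertices G' := by
  intro v
  obtain ⟨w, hw⟩ := h (e.symm v)
  refine ⟨e w, ?_⟩
  rwa [← e.map_adj_iff, e.apply_symm_apply] at hw

/-- A graph without isolated vertices that is not a tree is a spectral faux tree if it is cospectral
to a tree on any vertex set of the same size. -/
lemma IsSpectralFauxTree.of_cospectral {V W : Type*} [Fintype V] [Fintype W] {G : SimpleGraph V}
    {H : SimpleGraph W} (hG : NoIsolatedVertices G) (hGt : ¬ G.IsTree) (hH : H.IsTree)
    (h : normAdjSpectrum G = normAdjSpectrum H) (f : V ≃ W) : IsSpectralFauxTree G :=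
  ⟨hG, hGt, H.comap f, (SimpleGraph.Iso.comap f H).isTree_iff.2 hH,
    h.trans (normAdjSpectrum_eq_of_iso (SimpleGraph.Iso.comap f H)).symm⟩

lemma IsSpectralFauxTree.of_iso {V W : Type*} [Fintype V] [Fintype W] {G : SimpleGraph V}
    {G' : SimpleGraph W} (e : G ≃g G') (h : IsSpectralFauxTree G) : IsSpectralFauxTree G' := by
  obtain ⟨hG, hGt, H, hH, hs⟩ := h
  exact .of_cospectral (hG.of_iso e) (mt e.isTree_iff.2 hGt) hH
    ((normAdjSpectrum_eq_of_iso e).symm.trans hs) e.toEquiv.symm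

namespace FullBinTree

variable {T : FullBinTree} {α k : ℕ}

lemma ornamented_one_isTree (hα : 2 ≤ α) : (T.ornamented 1 α).IsTree := by
  rw [ornamented_isTree_iff le_rfl hα, one_mul, Nat.add_sub_cancel_left]

lemma not_ornamented_two_isTree (hα : 3 ≤ α) (hT : T.numInternal ≠ 0) :
    ¬ (T.ornamented 2 (α - 1)).IsTree := by
  rw [ornamented_isTree_iff (by omega) (by omega), Nat.mul_right_inj hT]
  omega

lemma normAdjSpectrum_ornamented_two (hα : 3 ≤ α) :
    normAdjSpectrum (T.ornamented 2 (α - 1)) = normAdjSpectrum (T.ornamented 1 α) :=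
  normAdjSpectrum_ornamented (by omega) (by omega) (by omega) (by omega) (by omega)

lemma isSpectralFauxTree_ornamented (hα : 3 ≤ α) (hT : T.numInternal ≠ 0) :
    IsSpectralFauxTree (T.ornamented 2 (α - 1)) := by
  have hcard : Nat.card (T.OrnVertex 2 (α - 1)) = Nat.card (T.OrnVertex 1 α) := by
    rw [card_ornVertex, card_ornVertex]
    congr 2
    omega
  exact .of_cospectral (ornamented_noIsolatedVertices hT) (not_ornamented_two_isTree hα hT)
    (ornamented_one_isTree (by omega)) (normAdjSpectrum_ornamented_two hα)
    ((Finite.equivFinOfCardEq hcard).trans (Finite.equivFin _).symm)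

lemma card_ornVertex_one (hα : 3 ≤ α) (hT : T.numInternal = k) :
    Nat.card (T.OrnVertex 1 α) = 1 + α * k := by
  rw [card_ornVertex, hT, mul_comm]
  congr 2
  omega

lemma card_ornVertex_two (hα : 3 ≤ α) (hT : T.numInternal = k) :
    Nat.card (T.OrnVertex 2 (α - 1)) = 1 + α * k := by
  rw [card_ornVertex, hT, mul_comm]
  congr 2
  omega

/-- Non-isomorphic full binary trees give non-isomorphic spectral faux trees. -/
lemma numIsoClasses_le_numSpectralFauxTrees (hα : 3 ≤ α) (hk : 1 ≤ k) :
    numIsoClasses (1 + 2 * k) ≤ numSpectralFauxTrees (1 + α * k) := by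
  have key : ∀ c ∈ Quotient.mk isoSetoid '' {T | Nat.card T.Vertex = 1 + 2 * k},
      ∃ G : SimpleGraph (Fin (1 + α * k)), IsSpectralFauxTree G ∧
        ∃ T, Quotient.mk isoSetoid T = c ∧ Nonempty (T.ornamented 2 (α - 1) ≃g G) := by
    rintro _ ⟨T, hT, rfl⟩
    have hT' := card_vertex_eq_iff.1 hT
    let f : Fin (1 + α * k) ≃ T.OrnVertex 2 (α - 1) :=
      (Finite.equivFinOfCardEq (card_ornVertex_two hα hT')).symm
    let e := SimpleGraph.Iso.comap f (T.ornamented 2 (α - 1))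
    exact ⟨_, (isSpectralFauxTree_ornamented hα (by omega)).of_iso e.symm, T, rfl, ⟨e.symm⟩⟩
  choose! g hg using key
  refine Set.ncard_le_ncard_of_injOn (fun c => Quotient.mk (graphIsoSetoid _) (g c))
    (fun c hc => ⟨g c, (hg c hc).1, rfl⟩) (fun c hc c' hc' h => ?_) (Set.toFinite _)
  obtain ⟨-, T, rfl, ⟨e⟩⟩ := hg c hc
  obtain ⟨-, T', rfl, ⟨e'⟩⟩ := hg c' hc'
  obtain ⟨f⟩ := Quotient.exact h
  exact Quotient.sound (iso_of_ornamented_iso le_rfl (by omega) ((e.trans f).trans e'.symm))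

end FullBinTree

open FullBinTree in
theorem mainTheorem6 (α : ℕ) (hα : 3 ≤ α) :
    -- there are exponentially many spectral faux trees on `1 + α k` vertices
    (∃ c : ℝ, 1 < c ∧
      ∀ᶠ k : ℕ in Filter.atTop, c ^ k ≤ (numSpectralFauxTrees (1 + α * k) : ℝ)) ∧
    -- every full binary tree on `1 + 2 k` vertices gives one
    (∀ k : ℕ, 1 ≤ k → ∀ T : FullBinTree, Nat.card T.Vertex = 1 + 2 * k →
      Nat.card (T.OrnVertex 1 α) = 1 + α * k ∧
      Nat.card (T.OrnVertex 2 (α - 1)) = 1 + α * k ∧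
      (T.ornamented 1 α).IsTree ∧
      ¬ (T.ornamented 2 (α - 1)).IsTree ∧
      normAdjSpectrum (T.ornamented 2 (α - 1)) = normAdjSpectrum (T.ornamented 1 α) ∧
      IsSpectralFauxTree (T.ornamented 2 (α - 1))) ∧
    -- different rooted trees give non-isomorphic graphs, and conversely
    (∀ T T' : FullBinTree,
      Nonempty (T.ornamented 2 (α - 1) ≃g T'.ornamented 2 (α - 1)) ↔ T.Iso T') ∧
    -- the count
    (∀ k : ℕ, 1 ≤ k →
      {T : FullBinTree | Nat.card T.Vertex = 1 + 2 * k}.ncard = catalan k ∧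
      catalan k ≤ 2 ^ (k - 1) * FullBinTree.numIsoClasses (1 + 2 * k) ∧
      FullBinTree.numIsoClasses (1 + 2 * k) ≤ numSpectralFauxTrees (1 + α * k)) := by
  refine ⟨⟨3 / 2, by norm_num, ?_⟩, fun k hk T hT => ?_, fun T T' => ?_, fun k hk => ?_⟩
  · filter_upwards [eventually_pow_le_numIsoClasses, Filter.eventually_ge_atTop 1] with k h hk
    exact h.trans (by exact_mod_cast numIsoClasses_le_numSpectralFauxTrees hα hk)
  · have hT' := card_vertex_eq_iff.1 hT
    exact ⟨card_ornVertex_one hα hT', card_ornVertex_two hα hT', ornamented_one_isTree (by omega),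
      not_ornamented_two_isTree hα (by omega), normAdjSpectrum_ornamented_two hα,
      isSpectralFauxTree_ornamented hα (by omega)⟩
  · exact ornamented_iso_iff le_rfl (by omega)
  · exact ⟨ncard_trees k, catalan_le_numIsoClasses k,
      numIsoClasses_le_numSpectralFauxTrees hα hk⟩
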